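/- Let $2^{<\omega}$ be the set of finite binary strings, and let $\preceq$ (resp. $\prec$) denote the initial segment (resp. proper initial segment) relation. Let $[2^{<\omega}]^2$ be the set of pairs $\langle\sigma,\tau\rangle$ of binary strings with $\sigma \prec \tau$. For $T \subseteq 2^{<\omega}$, write $T \cong 2^{<\omega}$ if there is a bijection $i : 2^{<\omega} \to T$ such that $\sigma \preceq \tau$ if and only if $i(\sigma) \preceq i(\tau)$ for all $\sigma,\tau \in 2^{<\omega}$. A coloring $f : [2^{<\omega}]^2 \to 2$ is stable over $T \cong 2^{<\omega}$ if for every $\sigma \in T$ there are a color $c < 2$ and a number $n$ such that $f(\sigma,\tau) = c$ for every $\tau \in T$ with $\tau \succ \sigma$ and $|\tau| > n$. Let $\mathsf{CTT}^2_2$ be the principle that for every $f : [2^{<\omega}]^2 \to 2$ there is a set $H \subseteq 2^{<\omega}$ such that $H \cong 2^{<\omega}$ and $f$ is stable over $H$. **Theorem.** $\mathsf{CTT}^2_2$ admits cone avoidance. That is, for every set $Z \subseteq \omega$, every set $C \subseteq \omega$ with $C \nleq_T Z$, and every $Z$-computable coloring $f : [2^{<\omega}]^2 \to 2$, there is a set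 $H \subseteq 2^{<\omega}$ such that $H \cong 2^{<\omega}$, $f$ is stable over $H$, and $C \nleq_T H \oplus Z$. (Here subsets of $2^{<\omega}$ are identified with subsets of $\omega$ through a standard computable coding of strings.) -/

import Mathlib

namespace ColoringTrees

/-- The characteristic function of a set `A` of natural numbers, as a (total) oracle. -/
noncomputable def oracle (A : Set ℕ) : ℕ →. ℕ := fun n => Part.some (A.indicator 1 n)

/-- `A ≤_T B`: the set `A` is Turing reducible to the set `B`. -/
def SetTuringReducible (A B : Set ℕ) : Prop := TuringReducible (oracle A) (oracle B)

/-- The join `A ⊕ B = {2n : n ∈ A} ∪ {2n+1 : n ∈ B}`. -/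
def join (A B : Set ℕ) : Set ℕ :=
  {m | (∃ n ∈ A, m = 2 * n) ∨ (∃ n ∈ B, m = 2 * n + 1)}

/-- `2^{<ω}`: finite binary strings. -/
abbrev BinStr : Type := List Bool

/-- `σ ≺ τ`: the string `σ` is a proper initial segment of `τ`. -/
abbrev ProperPrefix (σ τ : BinStr) : Prop := σ <+: τ ∧ σ ≠ τ

/-- The set of natural numbers that codes a set of strings. -/
def codeSet (H : Set BinStr) : Set ℕ := Encodable.encode '' H

/-- `[2^{<ω}]^2`: the pairs `⟨σ, τ⟩` with `σ ≺ τ`. -/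
abbrev StrPair : Type := {p : BinStr × BinStr // ProperPrefix p.1 p.2}

/-- A `k`-coloring of `[2^{<ω}]^2`. -/
abbrev PairColoring (k : ℕ) : Type := StrPair → Fin k

theorem primrecPred_properPrefix :
    PrimrecPred (fun p : BinStr × BinStr => ProperPrefix p.1 p.2) := by
  have h1 : PrimrecPred (fun p : BinStr × BinStr => p.2.take p.1.length = p.1) :=
    Primrec.eq.comp
      (Primrec.list_take.comp (Primrec.list_length.comp Primrec.fst) Primrec.snd) Primrec.fst
  have h2 : PrimrecPred (fun p : BinStr × BinStr => p.1 = p.2) :=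
    Primrec.eq.comp Primrec.fst Primrec.snd
  refine (h1.and h2.not).of_eq fun p => ?_
  rw [ProperPrefix, List.prefix_iff_eq_take, eq_comm (a := p.1) (b := p.2.take _)]

/-- The coding of `[2^{<ω}]^2` inherited from pairs of strings. -/
instance instPrimcodableStrPair : Primcodable StrPair :=
  Primcodable.subtype primrecPred_properPrefix

/-- The coloring `f` is computable from the set `Z`. -/
def ComputableFrom {k : ℕ} (Z : Set ℕ) (f : PairColoring k) : Prop :=
  ComputableIn {oracle Z} f

/-- `T ≅ 2^{<ω}`: there is a bijection `i : 2^{<ω} → T` with `σ ⪯ τ ↔ i σ ⪯ i τ`. -/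
def IsoFullTree (T : Set BinStr) : Prop :=
  ∃ i : BinStr → T, Function.Bijective i ∧
    ∀ σ τ : BinStr, σ <+: τ ↔ (i σ : BinStr) <+: (i τ : BinStr)

/-- `f` is stable over `T`: for each `σ ∈ T` there are a color `c` and a level `n` such that
`f(σ, τ) = c` for all `τ ∈ T` with `τ ≻ σ` and `|τ| > n`. -/
def StableOver {k : ℕ} (f : PairColoring k) (T : Set BinStr) : Prop :=
  ∀ σ ∈ T, ∃ (c : Fin k) (n : ℕ), ∀ τ ∈ T, ∀ h : ProperPrefix σ τ,
    n < τ.length → f ⟨(σ, τ), h⟩ = c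

end ColoringTrees

open ColoringTrees

namespace ColoringTrees

/-! The full binary tree is represented on `ℕ`, node `a` having children `2a+1` and `2a+2`, and the
solution is the range of an embedding `i` of this tree into itself. It is built by a
computable-Mathias style forcing. A condition (`Cond`) has a reservoir embedding `j`, a coloring `c`
pulled back along `j` with finitely many colors, and an oracle `o` computing `Z`, `j` and `c` but
not enumerating `Γ`, the coded graph of `C`. The nodes below `N` are frozen and their colors are
already decided on the part of the tree from `N` on. Since `C ≤_T X` exactly when `Γ` is `Σ⁰₁` in
`X`, it suffices that `Γ` is not `Σ⁰₁` in `Z ⊕ i`.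

Density: some node above a given one has a pattern of colors, seen by finitely many nodes, that is
dense above it (`exists_denseAbove`). A finite embedding whose leaves see dense patterns extends
computably to a full embedding realizing those colors (`exists_thinning`).

The core is `exists_ext_avoid`. For a candidate enumeration `R`, let `d` range over the bounded
colorings of pairs, viewed as guesses of the colors seen at the leaves. `Forces R d x` says that
some finite embedding, on which `d` gives each undecided node a single color at all leaves above it,
already satisfies `R` at `x`. By compactness, the set of `x` forced by every `d` is `Σ⁰₁` in `o`
(`Sig.forall_bdd`), so it differs from `Γ`. If some `x ∉ Γ` is forced by every `d`, take `d` to be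
the dense color patterns; the resulting finite embedding can be thinned to an extension that puts
`x` in. If some `x ∈ Γ` is not forced by some `d`, such `d` form a nonempty `Π⁰₁` class, so one of
them keeps `Γ` non-enumerable (`exists_not_s1_of_class`). Adding this `d` to the coloring ensures
that any embedding stable for the new coloring leaves `x` out, since a long finite part of it would
witness `Forces R d x`.

A sequence of conditions meeting all requirements and freezing ever more nodes converges to the
embedding wanted (`exists_mem_gen`). -/

/-- The first `n` values of `g`. -/
def res (g : ℕ → ℕ) (n : ℕ) : List ℕ := (List.range n).map g

@[simp] theorem length_res (g : ℕ → ℕ) (n : ℕ) : (res g n).length = n := by simp [res]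

theorem getElem?_res (g : ℕ → ℕ) (n a : ℕ) : (res g n)[a]? = if a < n then some (g a) else none := by
  by_cases h : a < n <;> simp [res, h]

theorem prefix_iff_getElem?' {α : Type*} {σ τ : List α} :
    σ <+: τ ↔ ∀ a < σ.length, σ[a]? = τ[a]? := by
  rw [List.prefix_iff_getElem?]
  exact ⟨fun h a ha => by simp [h a ha], fun h a ha => by simp [← h a ha]⟩

theorem prefix_res_iff (σ : List ℕ) (g : ℕ → ℕ) (n : ℕ) :
    σ <+: res g n ↔ σ.length ≤ n ∧ σ = res g σ.length := by
  constructor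
  · intro h
    have hl := h.length_le
    rw [length_res] at hl
    refine ⟨hl, List.ext_getElem? fun a => ?_⟩
    by_cases ha : a < σ.length
    · rw [prefix_iff_getElem?'.1 h a ha, getElem?_res, getElem?_res, if_pos ha,
        if_pos (ha.trans_le hl)]
    · rw [getElem?_res, if_neg ha, List.getElem?_eq_none (not_lt.1 ha)]
  · rintro ⟨hl, h⟩
    rw [prefix_iff_getElem?']
    intro a ha
    rw [h, getElem?_res, getElem?_res, if_pos ha, if_pos (ha.trans_le hl)]

theorem res_prefix_res (g : ℕ → ℕ) {m n : ℕ} (h : m ≤ n) : res g m <+: res g n := by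
  rw [prefix_res_iff]; simp [h]

theorem res_congr {g g' : ℕ → ℕ} {n : ℕ} (h : ∀ a < n, g a = g' a) : res g n = res g' n :=
  List.map_congr_left fun a ha => h a (List.mem_range.1 ha)

/-! ### Closure properties of relations that are `Σ⁰₁` uniformly in an oracle. -/

/-- `P i x` is a `Σ⁰₁` property of `x` relative to the oracle `ev i`, uniformly in `i`. -/
def Sig {I α : Type*} [Primcodable α] (ev : I → ℕ → ℕ) (P : I → α → Prop) : Prop :=
  ∃ R : List ℕ → α → Prop, PrimrecRel R ∧ (∀ σ τ x, σ <+: τ → R σ x → R τ x) ∧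
    ∀ i x, P i x ↔ ∃ n, R (res (ev i) n) x

namespace Sig

variable {I J α β : Type*} [Primcodable α] [Primcodable β]
  {ev : I → ℕ → ℕ}

theorem of_eq {P Q : I → α → Prop} (hP : Sig ev P) (h : ∀ i x, P i x ↔ Q i x) : Sig ev Q := by
  obtain ⟨R, h1, h2, h3⟩ := hP
  exact ⟨R, h1, h2, fun i x => (h i x).symm.trans (h3 i x)⟩

theorem prim {p : α → Prop} (hp : PrimrecPred p) : Sig ev fun _ x => p x :=
  ⟨fun _ x => p x, hp.comp Primrec.snd, fun _ _ _ _ h => h, fun _ _ => by simp⟩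

theorem comp {P : I → β → Prop} (hP : Sig ev P) {f : α → β} (hf : Primrec f) :
    Sig ev fun i x => P i (f x) := by
  obtain ⟨R, h1, h2, h3⟩ := hP
  exact ⟨fun σ x => R σ (f x), h1.comp Primrec.fst (hf.comp Primrec.snd),
    fun σ τ x => h2 σ τ (f x), fun i x => h3 i (f x)⟩

theorem and {P Q : I → α → Prop} (hP : Sig ev P) (hQ : Sig ev Q) :
    Sig ev fun i x => P i x ∧ Q i x := by
  obtain ⟨R, h1, h2, h3⟩ := hP
  obtain ⟨R', h1', h2', h3'⟩ := hQ
  refine ⟨fun σ x => R σ x ∧ R' σ x, PrimrecPred.and h1 h1',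
    fun σ τ x h => And.imp (h2 σ τ x h) (h2' σ τ x h), fun i x => ?_⟩
  beta_reduce
  rw [h3, h3']
  constructor
  · rintro ⟨⟨m, hm⟩, n, hn⟩
    exact ⟨max m n, h2 _ _ _ (res_prefix_res _ (le_max_left _ _)) hm,
      h2' _ _ _ (res_prefix_res _ (le_max_right _ _)) hn⟩
  · rintro ⟨n, h, h'⟩
    exact ⟨⟨n, h⟩, n, h'⟩

theorem or {P Q : I → α → Prop} (hP : Sig ev P) (hQ : Sig ev Q) :
    Sig ev fun i x => P i x ∨ Q i x := by
  obtain ⟨R, h1, h2, h3⟩ := hP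
  obtain ⟨R', h1', h2', h3'⟩ := hQ
  refine ⟨fun σ x => R σ x ∨ R' σ x, PrimrecPred.or h1 h1',
    fun σ τ x h => Or.imp (h2 σ τ x h) (h2' σ τ x h), fun i x => ?_⟩
  beta_reduce
  rw [h3, h3', exists_or]

/-- Only witnesses with code below the length of the oracle segment are tried, which keeps the
relation primitive recursive and monotone in the segment. -/
theorem ex {P : I → α → β → Prop} (hP : Sig ev fun i (p : α × β) => P i p.1 p.2) :
    Sig ev fun i x => ∃ y, P i x y := by
  obtain ⟨R, h1, h2, h3⟩ := hP
  refine ⟨fun σ x => ∃ y ∈ (List.range σ.length).flatMap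
    (fun n => (Encodable.decode (α := β) n).toList), R σ (x, y), ?_, ?_, ?_⟩
  · have : PrimrecRel fun (y : β) (p : List ℕ × α) => R p.1 (p.2, y) :=
      h1.comp (Primrec.fst.comp Primrec.snd)
        ((Primrec.snd.comp Primrec.snd).pair Primrec.fst)
    refine this.exists_mem_list.comp ?_ Primrec.id
    refine Primrec.list_flatMap (Primrec.list_range.comp (Primrec.list_length.comp Primrec.fst)) ?_
    exact Primrec.optionToList.comp (Primrec.decode.comp Primrec.snd)
  · rintro σ τ x h ⟨y, hy, hR⟩
    refine ⟨y, ?_, h2 _ _ _ h hR⟩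
    simp only [List.mem_flatMap, List.mem_range] at hy ⊢
    obtain ⟨n, hn, hy⟩ := hy
    exact ⟨n, hn.trans_le h.length_le, hy⟩
  · intro i x
    simp only [List.mem_flatMap, List.mem_range, length_res]
    constructor
    · rintro ⟨y, hy⟩
      obtain ⟨n, hn⟩ := (h3 i (x, y)).1 hy
      refine ⟨max n (Encodable.encode y + 1), y, ⟨Encodable.encode y, ?_, by simp⟩,
        h2 _ _ _ (res_prefix_res _ (le_max_left _ _)) hn⟩
      exact Nat.lt_of_succ_le (le_max_right _ _)
    · rintro ⟨n, y, -, hR⟩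
      exact ⟨y, (h3 i (x, y)).2 ⟨n, hR⟩⟩

/-- By monotonicity, the longest of finitely many oracle segments serves all members of the list at
once. -/
theorem all_mem {P : I → α → β → Prop} (hP : Sig ev fun i (p : α × β) => P i p.1 p.2)
    {F : α → List β} (hF : Primrec F) : Sig ev fun i x => ∀ y ∈ F x, P i x y := by
  obtain ⟨R, h1, h2, h3⟩ := hP
  refine ⟨fun σ x => ∀ y ∈ F x, R σ (x, y), ?_, ?_, ?_⟩
  · have : PrimrecRel fun (y : β) (p : List ℕ × α) => R p.1 (p.2, y) :=
      h1.comp (Primrec.fst.comp Primrec.snd)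
        ((Primrec.snd.comp Primrec.snd).pair Primrec.fst)
    exact this.forall_mem_list.comp (hF.comp Primrec.snd) Primrec.id
  · intro σ τ x h H y hy
    exact h2 _ _ _ h (H y hy)
  · intro i x
    constructor
    · intro H
      have : ∀ l : List β, (∀ y ∈ l, P i x y) → ∃ n, ∀ y ∈ l, R (res (ev i) n) (x, y) := by
        intro l
        induction l with
        | nil => simp
        | cons a l ih =>
          intro hl
          obtain ⟨n, hn⟩ := ih fun y hy => hl y (List.mem_cons_of_mem _ hy)
          obtain ⟨m, hm⟩ := (h3 i (x, a)).1 (hl a List.mem_cons_self)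
          refine ⟨max m n, fun y hy => ?_⟩
          rcases List.mem_cons.1 hy with rfl | hy
          · exact h2 _ _ _ (res_prefix_res _ (le_max_left _ _)) hm
          · exact h2 _ _ _ (res_prefix_res _ (le_max_right _ _)) (hn y hy)
      exact this _ H
    · rintro ⟨n, hn⟩ y hy
      exact (h3 i (x, y)).2 ⟨n, hn y hy⟩

theorem all_lt {P : I → α → ℕ → Prop} (hP : Sig ev fun i (p : α × ℕ) => P i p.1 p.2)
    {F : α → ℕ} (hF : Primrec F) : Sig ev fun i x => ∀ y < F x, P i x y :=
  (all_mem hP (Primrec.list_range.comp hF)).of_eq fun i x => by simp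

theorem imp_prim {P : I → α → Prop} (hP : Sig ev P) {p : α → Prop} (hp : PrimrecPred p) :
    Sig ev fun i x => p x → P i x :=
  ((prim hp.not).or hP).of_eq fun i x => by rw [imp_iff_not_or]

theorem eval {f g : α → ℕ} (hf : Primrec f) (hg : Primrec g) :
    Sig ev fun i x => ev i (f x) = g x := by
  refine ⟨fun σ x => σ[f x]? = some (g x), ?_, ?_, ?_⟩
  · exact Primrec.eq.comp (Primrec.list_getElem?.comp Primrec.fst (hf.comp Primrec.snd))
      (Primrec.option_some.comp (hg.comp Primrec.snd))
  · intro σ τ x h hσ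
    have : f x < σ.length := by
      by_contra hc
      simp [List.getElem?_eq_none (not_lt.1 hc)] at hσ
    rw [← prefix_iff_getElem?'.1 h _ this, hσ]
  · intro i x
    simp only [getElem?_res]
    constructor
    · intro h
      exact ⟨f x + 1, by simp [h]⟩
    · rintro ⟨n, hn⟩
      split_ifs at hn
      simpa using hn

/-- A positive answer uses a finite segment of the old oracle, so one can guess the segment and
verify it with the new oracle. -/
theorem subst {P : I → α → Prop} (hP : Sig ev P) {ev' : J → ℕ → ℕ} (π : J → I)
    (h : Sig ev' fun i (p : ℕ × ℕ) => ev (π i) p.1 = p.2) : Sig ev' fun i x => P (π i) x := by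
  obtain ⟨R, h1, h2, h3⟩ := hP
  have key : Sig ev' fun i x => ∃ σ : List ℕ,
      (∀ a < σ.length, ev (π i) a = σ.getD a 0) ∧ R σ x := by
    refine ex (and (all_lt ?_ (Primrec.list_length.comp Primrec.snd))
      (prim (h1.comp Primrec.snd Primrec.fst)))
    exact h.comp (Primrec.snd.pair ((Primrec.list_getD 0).comp
      (Primrec.snd.comp Primrec.fst) Primrec.snd))
  refine key.of_eq fun i x => ?_
  rw [h3]
  constructor
  · rintro ⟨σ, hσ, hR⟩
    refine ⟨σ.length, ?_⟩
    convert hR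
    refine List.ext_getElem? fun a => ?_
    rw [getElem?_res]
    split_ifs with ha
    · rw [hσ a ha]; simp [ha]
    · simp [not_lt.1 ha]
  · rintro ⟨n, hn⟩
    refine ⟨_, fun a ha => ?_, hn⟩
    rw [length_res] at ha
    rw [List.getD, getElem?_res, if_pos ha, Option.getD_some]

end Sig

/-! ### Computability in one oracle: joins, uniformization, dependent choice. -/

/-- `Σ⁰₁` relative to a single oracle. -/
def S1 {α : Type*} [Primcodable α] (o : ℕ → ℕ) (P : α → Prop) : Prop :=
  Sig (fun _ : Unit => o) fun _ x => P x

/-- A function whose graph is `Σ⁰₁` in the oracle. -/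
def Comp {α β : Type*} [Primcodable α] [Primcodable β] (o : ℕ → ℕ) (F : α → β) : Prop :=
  S1 o fun p : α × β => F p.1 = p.2

theorem S1.sig {I α : Type*} [Primcodable α] {o : ℕ → ℕ} {P : α → Prop} (h : S1 o P)
    {ev : I → ℕ → ℕ} (ho : Sig ev fun _ (p : ℕ × ℕ) => o p.1 = p.2) : Sig ev fun _ x => P x :=
  Sig.subst h (fun _ => ()) ho

theorem S1.trans {α : Type*} [Primcodable α] {o o' : ℕ → ℕ} {P : α → Prop} (h : S1 o P)
    (ho : Comp o' o) : S1 o' P := h.sig ho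

theorem Comp.refl (o : ℕ → ℕ) : Comp o o := Sig.eval Primrec.fst Primrec.snd

theorem Comp.trans {α β : Type*} [Primcodable α] [Primcodable β] {o o' : ℕ → ℕ} {F : α → β}
    (h : Comp o F) (ho : Comp o' o) : Comp o' F := S1.trans h ho

theorem Comp.of_primrec {α β : Type*} [Primcodable α] [Primcodable β] {o : ℕ → ℕ} {F : α → β}
    (h : Primrec F) : Comp o F :=
  Sig.prim (Primrec.eq.comp (h.comp Primrec.fst) Primrec.snd)

theorem Comp.comp {α β γ : Type*} [Primcodable α] [Primcodable β] [Primcodable γ] {o : ℕ → ℕ}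
    {F : β → γ} {G : α → β} (hF : Comp o F) (hG : Comp o G) : Comp o fun x => F (G x) := by
  have : S1 o fun p : α × γ => ∃ y, G p.1 = y ∧ F y = p.2 := by
    refine Sig.ex (Sig.and ?_ ?_)
    · exact Sig.comp hG ((Primrec.fst.comp Primrec.fst).pair Primrec.snd)
    · exact Sig.comp hF (Primrec.snd.pair (Primrec.snd.comp Primrec.fst))
  exact this.of_eq fun _ p => by simp

theorem Comp.pair {α β γ : Type*} [Primcodable α] [Primcodable β] [Primcodable γ] {o : ℕ → ℕ}
    {F : α → β} {G : α → γ} (hF : Comp o F) (hG : Comp o G) : Comp o fun x => (F x, G x) := by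
  have : S1 o fun p : α × (β × γ) => F p.1 = p.2.1 ∧ G p.1 = p.2.2 :=
    Sig.and (Sig.comp hF (Primrec.fst.pair (Primrec.fst.comp Primrec.snd)))
      (Sig.comp hG (Primrec.fst.pair (Primrec.snd.comp Primrec.snd)))
  exact this.of_eq fun _ p => by simp [Prod.ext_iff]

/-- The join of two oracles. -/
def pr (o d : ℕ → ℕ) : ℕ → ℕ := fun n => Nat.pair (o n) (d n)

theorem Sig.pr_left {I : Type*} (o d : I → ℕ → ℕ) :
    Sig (fun i => pr (o i) (d i)) fun i (p : ℕ × ℕ) => o i p.1 = p.2 := by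
  have : Sig (fun i => pr (o i) (d i)) fun i (p : ℕ × ℕ) =>
      ∃ b : ℕ, pr (o i) (d i) p.1 = Nat.pair p.2 b :=
    Sig.ex (Sig.eval (ev := fun i => pr (o i) (d i)) (Primrec.fst.comp Primrec.fst)
      (Primrec₂.natPair.comp (Primrec.snd.comp Primrec.fst) Primrec.snd))
  exact this.of_eq fun i p => by simp [pr, Nat.pair_eq_pair]

theorem Sig.pr_right {I : Type*} (o d : I → ℕ → ℕ) :
    Sig (fun i => pr (o i) (d i)) fun i (p : ℕ × ℕ) => d i p.1 = p.2 := by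
  have : Sig (fun i => pr (o i) (d i)) fun i (p : ℕ × ℕ) =>
      ∃ b : ℕ, pr (o i) (d i) p.1 = Nat.pair b p.2 :=
    Sig.ex (Sig.eval (ev := fun i => pr (o i) (d i)) (Primrec.fst.comp Primrec.fst)
      (Primrec₂.natPair.comp Primrec.snd (Primrec.snd.comp Primrec.fst)))
  exact this.of_eq fun i p => by simp [pr, Nat.pair_eq_pair]

theorem Sig.res_eq {I : Type*} (ev : I → ℕ → ℕ) :
    Sig ev fun i (p : ℕ × List ℕ) => res (ev i) p.1 = p.2 := by
  have : Sig ev fun i (p : ℕ × List ℕ) =>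
      p.2.length = p.1 ∧ ∀ a < p.1, ev i a = p.2.getD a 0 := by
    refine Sig.and (Sig.prim ?_) (Sig.all_lt ?_ Primrec.fst)
    · exact Primrec.eq.comp (Primrec.list_length.comp Primrec.snd) Primrec.fst
    · exact Sig.eval Primrec.snd ((Primrec.list_getD 0).comp
        (Primrec.snd.comp Primrec.fst) Primrec.snd)
  refine this.of_eq ?_
  rintro i ⟨n, σ⟩
  dsimp only
  constructor
  · rintro ⟨rfl, h⟩
    refine List.ext_getElem? fun a => ?_
    rw [getElem?_res]
    split_ifs with ha
    · rw [h a ha]; simp [show a < σ.length from ha]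
    · simp [not_lt.1 ha]
  · rintro rfl
    refine ⟨length_res _ _, fun a ha => ?_⟩
    rw [List.getD, getElem?_res, if_pos ha, Option.getD_some]

/-- Uniformization of `Σ⁰₁` relations. -/
theorem S1.uniformize {α β : Type*} [Primcodable α] [Primcodable β] {o : ℕ → ℕ} {A : α → β → Prop}
    (hA : S1 o fun p : α × β => A p.1 p.2) :
    ∃ F : α → β → Prop, (S1 o fun p : α × β => F p.1 p.2) ∧ (∀ x y, F x y → A x y) ∧
      (∀ x y y', F x y → F x y' → y = y') ∧ ∀ x, (∃ y, A x y) → ∃ y, F x y := by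
  classical
  obtain ⟨R, h1, h2, h3⟩ := hA
  replace h3 : ∀ x y, A x y ↔ ∃ n, R (res o n) (x, y) := fun x y => h3 () (x, y)
  let T : List ℕ → ℕ → α → Prop := fun σ s x =>
    ∃ y ∈ (Encodable.decode (α := β) s).toList, R σ (x, y)
  have hT : PrimrecPred fun p : List ℕ × ℕ × α => T p.1 p.2.1 p.2.2 := by
    have : PrimrecRel fun (y : β) (p : List ℕ × ℕ × α) => R p.1 (p.2.2, y) :=
      h1.comp (Primrec.fst.comp Primrec.snd)
        ((Primrec.snd.comp (Primrec.snd.comp Primrec.snd)).pair Primrec.fst)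
    exact this.exists_mem_list.comp (Primrec.optionToList.comp
      (Primrec.decode.comp (Primrec.fst.comp Primrec.snd))) Primrec.id
  let W : ℕ → α → Prop := fun s x => T (res o s.unpair.2) s.unpair.1 x
  -- A stage `s` codes a candidate value and an oracle length, so `W` reads one fixed finite segment
  -- and its negation is `Σ⁰₁` as well. Hence being the least successful stage is `Σ⁰₁`.
  have hnW : S1 o fun p : ℕ × α => ¬ W p.1 p.2 := by
    have : S1 o fun p : ℕ × α => ∃ σ : List ℕ, res o p.1.unpair.2 = σ ∧
        ¬ T σ p.1.unpair.1 p.2 := by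
      refine Sig.ex (Sig.and ?_ (Sig.prim ?_))
      · exact (Sig.res_eq fun _ : Unit => o).comp ((Primrec.snd.comp
          (Primrec.unpair.comp (Primrec.fst.comp Primrec.fst))).pair Primrec.snd)
      · exact (hT.comp (Primrec.snd.pair ((Primrec.fst.comp
          (Primrec.unpair.comp (Primrec.fst.comp Primrec.fst))).pair
            (Primrec.snd.comp Primrec.fst)))).not
    exact this.of_eq fun _ p => by simp [W]
  refine ⟨fun x y => ∃ s : ℕ, (Encodable.decode (α := β) s.unpair.1 = some y ∧
    ∃ σ : List ℕ, res o s.unpair.2 = σ ∧ R σ (x, y)) ∧ ∀ s' < s, ¬ W s' x, ?_, ?_, ?_, ?_⟩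
  · refine Sig.ex (Sig.and (Sig.and (Sig.prim ?_) (Sig.ex (Sig.and ?_ (Sig.prim ?_)))) ?_)
    · exact Primrec.eq.comp (Primrec.decode.comp (Primrec.fst.comp
        (Primrec.unpair.comp Primrec.snd)))
        (Primrec.option_some.comp (Primrec.snd.comp Primrec.fst))
    · exact (Sig.res_eq fun _ : Unit => o).comp ((Primrec.snd.comp
          (Primrec.unpair.comp (Primrec.snd.comp Primrec.fst))).pair Primrec.snd)
    · exact h1.comp Primrec.snd (Primrec.fst.comp Primrec.fst)
    · exact Sig.all_lt (hnW.comp (Primrec.snd.pair (Primrec.fst.comp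
        (Primrec.fst.comp Primrec.fst)))) Primrec.snd
  · rintro x y ⟨s, ⟨-, σ, rfl, hR⟩, -⟩
    exact (h3 x y).2 ⟨_, hR⟩
  · rintro x y y' ⟨s, ⟨hs, σ, rfl, hR⟩, hm⟩ ⟨s', ⟨hs', σ', rfl, hR'⟩, hm'⟩
    have e : s = s' := by
      rcases lt_trichotomy s s' with h | h | h
      · exact absurd ⟨y, by simp [hs], hR⟩ (hm' s h)
      · exact h
      · exact absurd ⟨y', by simp [hs'], hR'⟩ (hm s' h)
    subst e
    exact Option.some_injective _ (hs.symm.trans hs')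
  · rintro x ⟨y, hy⟩
    obtain ⟨n, hn⟩ := (h3 x y).1 hy
    have hex : ∃ s, W s x := ⟨Nat.pair (Encodable.encode y) n, y, by simp, by simpa using hn⟩
    obtain ⟨y', hy', hR⟩ := Nat.find_spec hex
    exact ⟨y', Nat.find hex, ⟨by simpa using hy', _, rfl, hR⟩, fun s' hs' => Nat.find_min hex hs'⟩

theorem res_succ (g : ℕ → ℕ) (n : ℕ) : res g (n + 1) = res g n ++ [g n] := by
  simp [res, List.range_succ]

/-- Computable dependent choice along a `Σ⁰₁` relation. -/
theorem S1.dependent_choice {o : ℕ → ℕ} {A : List ℕ → ℕ → Prop}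
    (hA : S1 o fun p : List ℕ × ℕ => A p.1 p.2) {Inv : List ℕ → Prop} (h0 : Inv [])
    (hex : ∀ L, Inv L → ∃ v, A L v) (hinv : ∀ L v, Inv L → A L v → Inv (L ++ [v])) :
    ∃ K : ℕ → ℕ, Comp o K ∧ ∀ b, Inv (res K b) ∧ A (res K b) (K b) := by
  obtain ⟨F, hF, hFA, hFun, hFex⟩ := hA.uniformize
  choose ν hν using fun L : {L // Inv L} => hFex L.1 (hex L.1 L.2)
  let S : ℕ → {L // Inv L} := fun n => n.rec ⟨[], h0⟩ fun _ L =>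
    ⟨L.1 ++ [ν L], hinv _ _ L.2 (hFA _ _ (hν L))⟩
  let K : ℕ → ℕ := fun n => ν (S n)
  have hS : ∀ n, res K n = (S n).1 := by
    intro n
    induction n with
    | zero => rfl
    | succ n ih => rw [res_succ, ih]
  have hFK : ∀ b, F (res K b) (K b) := fun b => by rw [hS]; exact hν (S b)
  refine ⟨K, ?_, fun b => ⟨by rw [hS]; exact (S b).2, hFA _ _ (hFK b)⟩⟩
  -- The value at `b` is certified by a whole history `L`, which must be the true one because `F` is
  -- single-valued.
  have : S1 o fun p : ℕ × ℕ => ∃ L : List ℕ, L.length = p.1 ∧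
      (∀ i < L.length, F (L.take i) (L.getD i 0)) ∧ F L p.2 := by
    refine Sig.ex (Sig.and (Sig.prim ?_) (Sig.and (Sig.all_lt ?_
      (Primrec.list_length.comp Primrec.snd)) ?_))
    · exact Primrec.eq.comp (Primrec.list_length.comp Primrec.snd)
        (Primrec.fst.comp Primrec.fst)
    · exact hF.comp ((Primrec.list_take.comp Primrec.snd (Primrec.snd.comp Primrec.fst)).pair
        ((Primrec.list_getD 0).comp (Primrec.snd.comp Primrec.fst) Primrec.snd))
    · exact hF.comp (Primrec.snd.pair (Primrec.snd.comp Primrec.fst))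
  refine this.of_eq ?_
  rintro - ⟨b, v⟩
  dsimp only
  constructor
  · rintro ⟨L, hL, hi, hv⟩
    have : ∀ i ≤ L.length, L.take i = res K i := by
      intro i
      induction i with
      | zero => simp [res]
      | succ i ih =>
        intro h
        have e := ih (by omega)
        rw [res_succ, ← e, List.take_add_one]
        congr 1
        have h1 := hi i h
        rw [e] at h1
        have := hFun _ _ _ h1 (hFK i)
        rw [← this]
        simp [show i < L.length from h]
    have e := this L.length le_rfl
    rw [List.take_length, hL] at e
    rw [e] at hv
    exact hFun _ _ _ (hFK b) hv
  · rintro rfl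
    refine ⟨res K b, length_res _ _, fun i hi => ?_, hFK b⟩
    rw [length_res] at hi
    have h1 : (res K b).take i = res K i := by
      have := List.prefix_iff_eq_take.1 (res_prefix_res K hi.le)
      rw [length_res] at this
      exact this.symm
    rw [h1, List.getD, getElem?_res, if_pos hi]
    exact hFK i

/-- Each such relation is determined by a code for its characteristic function. This supplies the
list of requirements for both diagonalizations. -/
theorem countable_primrecRel {α β : Type*} [Primcodable α] [Primcodable β] :
    {R : α → β → Prop | PrimrecRel R}.Countable := by
  refine (Set.countable_range fun (c : Nat.Partrec.Code) (x : α) (y : β) =>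
    1 ∈ c.eval (Encodable.encode (x, y))).mono ?_
  rintro R ⟨hd, hR⟩
  obtain ⟨c, hc⟩ := Nat.Partrec.Code.exists_code.1 hR.to_comp
  refine ⟨c, ?_⟩
  funext x y
  beta_reduce
  rw [hc]
  simp [PFun.coe_val, Part.mem_some_iff]
  by_cases h : R x y <;> simp [h]

/-! ### Effective compactness and cone avoidance for `Π⁰₁` classes. -/

/-- Functions with values below `r`. -/
def Bdd (r : ℕ) : Set (ℕ → ℕ) := {d | ∀ n, d n < r}

theorem isCompact_bdd (r : ℕ) : IsCompact (Bdd r) := by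
  have : Bdd r = Set.pi Set.univ fun _ => Set.Iio r := by ext; simp [Bdd]
  rw [this]
  exact isCompact_univ_pi fun _ => (Set.finite_Iio r).isCompact

theorem isOpen_res {o : ℕ → ℕ} (p : List ℕ → Prop) (n : ℕ) :
    IsOpen {d : ℕ → ℕ | p (res (pr o d) n)} := by
  have h : Continuous fun (d : ℕ → ℕ) (i : Fin n) => d i :=
    continuous_pi fun i => continuous_apply _
  have e : {d : ℕ → ℕ | p (res (pr o d) n)} = (fun (d : ℕ → ℕ) (i : Fin n) => d i) ⁻¹'
      {g | p (res (pr o fun a => if h : a < n then g ⟨a, h⟩ else 0) n)} := by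
    ext d
    simp only [Set.mem_ofPred_eq, Set.mem_preimage]
    rw [res_congr (g := pr o d)]
    intro a ha
    simp [pr, ha]
  rw [e]
  exact (isOpen_discrete _).preimage h

/-- A `Σ⁰₁` class is open. -/
theorem Sig.isOpen {α : Type*} [Primcodable α] {o : ℕ → ℕ} {V : (ℕ → ℕ) → α → Prop}
    (hV : Sig (fun d => pr o d) V) (x : α) : IsOpen {d | V d x} := by
  obtain ⟨R, -, -, h3⟩ := hV
  have : {d | V d x} = ⋃ n, {d : ℕ → ℕ | R (res (pr o d) n) x} := by
    ext d; simp [h3 d x]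
  rw [this]
  exact isOpen_iUnion fun n => isOpen_res (fun σ => R σ x) n

/-- All lists of length `n` with entries below `r`. -/
def allLists (r n : ℕ) : List (List ℕ) :=
  n.rec [[]] fun _ L => L.flatMap fun δ => (List.range r).map fun v => δ ++ [v]

theorem primrec_allLists (r : ℕ) : Primrec (allLists r) := by
  refine Primrec.nat_rec₁ _ ?_
  refine Primrec.list_flatMap Primrec.snd ?_
  refine Primrec.list_map (Primrec.const _) ?_
  exact Primrec.list_concat.comp (Primrec.snd.comp Primrec.fst) Primrec.snd

theorem mem_allLists {r n : ℕ} {δ : List ℕ} (h : δ ∈ allLists r n) :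
    δ.length = n ∧ ∀ v ∈ δ, v < r := by
  induction n generalizing δ with
  | zero => simp [allLists] at h; simp [h]
  | succ n ih =>
    have : δ ∈ (allLists r n).flatMap fun δ => (List.range r).map fun v => δ ++ [v] := h
    simp only [List.mem_flatMap, List.mem_map, List.mem_range] at this
    obtain ⟨δ', h', v, hv, rfl⟩ := this
    obtain ⟨h1, h2⟩ := ih h'
    refine ⟨by simp [h1], fun w hw => ?_⟩
    simp at hw
    rcases hw with hw | rfl
    · exact h2 w hw
    · exact hv

theorem res_mem_allLists {r : ℕ} {d : ℕ → ℕ} (h : d ∈ Bdd r) (n : ℕ) : res d n ∈ allLists r n := by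
  induction n with
  | zero => simp [allLists, res]
  | succ n ih =>
    show _ ∈ (allLists r n).flatMap fun δ => (List.range r).map fun v => δ ++ [v]
    simp only [List.mem_flatMap, List.mem_map, List.mem_range]
    exact ⟨_, ih, d n, h n, (res_succ _ _).symm⟩

/-- Effective compactness. -/
theorem Sig.forall_bdd {α : Type*} [Primcodable α] {o : ℕ → ℕ} {U : (ℕ → ℕ) → α → Prop}
    (hU : Sig (fun d => pr o d) U) {r : ℕ} (hr : 0 < r) :
    S1 o fun x => ∀ d ∈ Bdd r, U d x := by
  obtain ⟨R, h1, h2, h3⟩ := hU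
  let zp : List ℕ → List ℕ → List ℕ := fun τ δ =>
    (List.range τ.length).map fun a => Nat.pair (τ.getD a 0) (δ.getD a 0)
  have hzp : Primrec₂ zp := by
    refine Primrec.list_map (Primrec.list_range.comp (Primrec.list_length.comp Primrec.fst)) ?_
    exact Primrec₂.natPair.comp
      ((Primrec.list_getD 0).comp (Primrec.fst.comp Primrec.fst) Primrec.snd)
      ((Primrec.list_getD 0).comp (Primrec.snd.comp Primrec.fst) Primrec.snd)
  -- By compactness one length works for all `d`, so finitely many strings `δ` of that length have
  -- to be checked.
  have key : S1 o fun x => ∃ τ : List ℕ, res o τ.length = τ ∧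
      ∀ δ ∈ allLists r τ.length, R (zp τ δ) x := by
    refine Sig.ex (Sig.and ?_ (Sig.all_mem (Sig.prim ?_)
      ((primrec_allLists r).comp (Primrec.list_length.comp Primrec.snd))))
    · exact (Sig.res_eq fun _ : Unit => o).comp
        ((Primrec.list_length.comp Primrec.snd).pair Primrec.snd)
    · exact h1.comp (hzp.comp (Primrec.snd.comp Primrec.fst) Primrec.snd)
        (Primrec.fst.comp Primrec.fst)
  have hz : ∀ (d : ℕ → ℕ) n δ, res d n = δ → zp (res o n) δ = res (pr o d) n := by
    rintro d n _ rfl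
    simp only [zp, length_res]
    conv_rhs => rw [res]
    refine List.map_congr_left fun a ha => ?_
    simp only [List.mem_range] at ha
    simp only [List.getD, getElem?_res, if_pos ha, Option.getD_some, pr]
  refine key.of_eq ?_
  intro _ x
  constructor
  · rintro ⟨τ, hτ, H⟩ d hd
    have := H _ (res_mem_allLists hd τ.length)
    rw [← hτ, length_res, hz d _ _ rfl] at this
    exact (h3 d x).2 ⟨_, this⟩
  · intro H
    obtain ⟨n, hn⟩ := (isCompact_bdd r).elim_directed_cover
      (fun n => {d : ℕ → ℕ | R (res (pr o d) n) x}) (fun n => isOpen_res (fun σ => R σ x) n)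
      (fun d hd => by simpa using (h3 d x).1 (H d hd))
      (Monotone.directed_le fun m n hmn d hd => h2 _ _ _ (res_prefix_res _ hmn) hd)
    refine ⟨res o n, by simp, fun δ hδ => ?_⟩
    rw [length_res] at hδ
    obtain ⟨hl, hv⟩ := mem_allLists hδ
    -- Padding `δ` with zeros stays below `r` because `0 < r`.
    have hd : (fun a => δ.getD a 0) ∈ Bdd r := by
      intro a
      by_cases ha : a < δ.length
      · simpa [ha] using hv _ (List.getElem_mem ha)
      · simpa [not_lt.1 ha] using hr
    rw [hz (fun a => δ.getD a 0)]
    · exact hn hd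
    · refine List.ext_getElem? fun a => ?_
      rw [getElem?_res]
      split_ifs with ha
      · simp [hl, ha]
      · simp [hl, not_lt.1 ha]

/-- Cone avoidance for `Π⁰₁` classes. -/
theorem exists_not_s1_of_class {α : Type*} [Primcodable α] {o : ℕ → ℕ} {Γ : α → Prop}
    (hΓ : ¬ S1 o Γ) {r : ℕ} (hr : 0 < r) {V : (ℕ → ℕ) → Unit → Prop}
    (hV : Sig (fun d => pr o d) V) (hne : ∃ d ∈ Bdd r, ¬ V d ()) :
    ∃ d ∈ Bdd r, ¬ V d () ∧ ¬ S1 (pr o d) Γ := by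
  obtain ⟨e, he⟩ := (countable_primrecRel (α := List ℕ) (β := α)).exists_eq_range
    ⟨fun _ _ => False, PrimrecPred.of_eq ((Primrec.eq.comp (Primrec.const 0) (Primrec.const 1))) (by simp)⟩
  -- A nonempty `Π⁰₁` class is given by its `Σ⁰₁` complement `V`; shrinking the class means
  -- enlarging `V`.
  let C := {V : (ℕ → ℕ) → Unit → Prop // Sig (fun d => pr o d) V ∧ ∃ d ∈ Bdd r, ¬ V d ()}
  have step : ∀ (n : ℕ) (V : C), ∃ V' : C, (∀ d, V.1 d () → V'.1 d ()) ∧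
      ∀ d ∈ Bdd r, ¬ V'.1 d () → (∀ σ τ x, σ <+: τ → e n σ x → e n τ x) →
        ¬ ∀ x, Γ x ↔ ∃ m, e n (res (pr o d) m) x := by
    intro n V
    by_cases hmono : ∀ σ τ x, σ <+: τ → e n σ x → e n τ x
    swap
    · exact ⟨V, fun _ h => h, fun _ _ _ h => absurd h hmono⟩
    have hen : PrimrecRel (e n) := by
      have : e n ∈ Set.range e := ⟨n, rfl⟩
      rw [← he] at this
      exact this
    let P : (ℕ → ℕ) → α → Prop := fun d x => ∃ m, e n (res (pr o d) m) x
    have hP : Sig (fun d => pr o d) P := ⟨e n, hen, hmono, fun _ _ => Iff.rfl⟩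
    let W : (ℕ → ℕ) → α → Prop := fun d x => V.1 d () ∨ P d x
    have hW : Sig (fun d => pr o d) W := (V.2.1.comp (Primrec.const ())).or hP
    have hQ := hW.forall_bdd hr
    -- The set in `hQ` is `Σ⁰₁` in `o`, so it differs from `Γ` at some `x`. If `x ∈ Γ`, restrict the
    -- class to those `d` that leave `x` out; if `x ∉ Γ`, every `d` in the class already puts `x`
    -- in.
    by_cases h1 : ∃ x, Γ x ∧ ∃ d ∈ Bdd r, ¬ W d x
    · obtain ⟨x, hx, d, hd, hdx⟩ := h1
      refine ⟨⟨fun d _ => W d x, hW.comp (Primrec.const x), d, hd, hdx⟩, fun d h => Or.inl h, ?_⟩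
      intro d _ hd' _ H
      exact hd' (Or.inr ((H x).1 hx))
    push Not at h1
    have h2 : ∃ x, ¬ Γ x ∧ ∀ d ∈ Bdd r, W d x := by
      by_contra hc
      push Not at hc
      refine hΓ (hQ.of_eq fun _ x => ⟨fun h => ?_, fun h => h1 x h⟩)
      by_contra hx
      obtain ⟨d, hd, hdx⟩ := hc x hx
      exact hdx (h d hd)
    obtain ⟨x, hx, H⟩ := h2
    refine ⟨V, fun _ h => h, fun d hd hdV _ hc => ?_⟩
    rcases H d hd with h | h
    · exact hdV h
    · exact hx ((hc x).2 h)
  choose f hf1 hf2 using step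
  let S : ℕ → C := fun n => n.rec ⟨V, hV, hne⟩ fun n V => f n V
  have hne' : (⋂ n, (Bdd r ∩ {d | ¬ (S n).1 d ()})).Nonempty := by
    refine IsCompact.nonempty_iInter_of_sequence_nonempty_isCompact_isClosed _ ?_ ?_ ?_ ?_
    · rintro n d ⟨hd, h⟩
      exact ⟨hd, fun hc => h (hf1 n (S n) d hc)⟩
    · intro n
      obtain ⟨d, hd, h⟩ := (S n).2.2
      exact ⟨d, hd, h⟩
    · exact (isCompact_bdd r).inter_right ((S 0).2.1.isOpen ()).isClosed_compl
    · exact fun n => (isCompact_bdd r).isClosed.inter ((S n).2.1.isOpen ()).isClosed_compl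
  obtain ⟨d, hd⟩ := hne'
  simp only [Set.mem_iInter] at hd
  refine ⟨d, (hd 0).1, (hd 0).2, ?_⟩
  rintro ⟨R, h1, h2, h3⟩
  have : R ∈ Set.range e := by rw [← he]; exact h1
  obtain ⟨n, rfl⟩ := this
  exact hf2 n (S n) d (hd 0).1 (hd (n + 1)).2 h2 fun x => h3 () x

/-! ### Turing reducibility as having a `Σ⁰₁` graph. -/

/-- Normal form: functions recursive in a total oracle have a `Σ⁰₁` graph. -/
theorem s1_of_recursiveIn {o : ℕ → ℕ} {φ : ℕ →. ℕ}
    (h : Nat.RecursiveIn {fun n => Part.some (o n)} φ) : S1 o fun p : ℕ × ℕ => p.2 ∈ φ p.1 := by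
  have prim : ∀ {f : ℕ → ℕ}, Primrec f → S1 o fun p : ℕ × ℕ => p.2 ∈ (f : ℕ →. ℕ) p.1 := fun hf =>
    Sig.of_eq (Comp.of_primrec hf) fun _ p => by simp [eq_comm]
  induction h with
  | zero => exact prim (Primrec.const 0)
  | succ => exact prim Primrec.succ
  | left => exact prim (Primrec.fst.comp Primrec.unpair)
  | right => exact prim (Primrec.snd.comp Primrec.unpair)
  | oracle g hg =>
    obtain rfl : g = fun n => Part.some (o n) := hg
    exact Sig.of_eq (Comp.refl o) fun _ p => by simp [eq_comm]
  | @pair f g _ _ hf hg =>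
    have : S1 o fun p : ℕ × ℕ => p.2.unpair.1 ∈ f p.1 ∧ p.2.unpair.2 ∈ g p.1 :=
      Sig.and (hf.comp (Primrec.fst.pair (Primrec.fst.comp (Primrec.unpair.comp Primrec.snd))))
        (hg.comp (Primrec.fst.pair (Primrec.snd.comp (Primrec.unpair.comp Primrec.snd))))
    refine this.of_eq fun _ p => ?_
    simp only [Seq.seq, Part.map_eq_map, Part.bind_map, Part.mem_bind_iff, Part.mem_map_iff]
    constructor
    · rintro ⟨h1, h2⟩
      exact ⟨_, h1, _, h2, by simp⟩
    · rintro ⟨a, ha, b, hb, e⟩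
      rw [← e, Nat.unpair_pair]
      exact ⟨ha, hb⟩
  | @comp f g _ _ hf hg =>
    have : S1 o fun p : ℕ × ℕ => ∃ y : ℕ, y ∈ g p.1 ∧ p.2 ∈ f y :=
      Sig.ex (Sig.and (hg.comp ((Primrec.fst.comp Primrec.fst).pair Primrec.snd))
        (hf.comp (Primrec.snd.pair (Primrec.snd.comp Primrec.fst))))
    exact this.of_eq fun _ p => Part.mem_bind_iff.symm
  | @prec f g _ _ hf hg =>
    -- `L` is the list of intermediate values of the recursion.
    have : S1 o fun p : ℕ × ℕ => ∃ L : List ℕ, (L.getD 0 0 ∈ f p.1.unpair.1 ∧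
        L.getD p.1.unpair.2 0 = p.2) ∧ ∀ y < p.1.unpair.2,
          L.getD (y + 1) 0 ∈ g (Nat.pair p.1.unpair.1 (Nat.pair y (L.getD y 0))) := by
      have u1 : Primrec fun q : (ℕ × ℕ) × List ℕ => q.1.1.unpair.1 :=
        Primrec.fst.comp (Primrec.unpair.comp (Primrec.fst.comp Primrec.fst))
      have u2 : Primrec fun q : (ℕ × ℕ) × List ℕ => q.1.1.unpair.2 :=
        Primrec.snd.comp (Primrec.unpair.comp (Primrec.fst.comp Primrec.fst))
      refine Sig.ex (Sig.and (Sig.and ?_ (Sig.prim ?_)) (Sig.all_lt ?_ u2))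
      · exact hf.comp (u1.pair ((Primrec.list_getD 0).comp Primrec.snd (Primrec.const 0)))
      · exact Primrec.eq.comp ((Primrec.list_getD 0).comp Primrec.snd u2)
          (Primrec.snd.comp Primrec.fst)
      · refine hg.comp (Primrec.pair ?_ ?_)
        · exact Primrec₂.natPair.comp (u1.comp Primrec.fst) (Primrec₂.natPair.comp Primrec.snd
            ((Primrec.list_getD 0).comp (Primrec.snd.comp Primrec.fst) Primrec.snd))
        · exact (Primrec.list_getD 0).comp (Primrec.snd.comp Primrec.fst)
            (Primrec.succ.comp Primrec.snd)
    refine this.of_eq ?_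
    rintro - ⟨x, v⟩
    obtain ⟨a, n, rfl⟩ : ∃ a n, x = Nat.pair a n := ⟨_, _, (Nat.pair_unpair x).symm⟩
    simp only [Nat.unpair_pair]
    let G : ℕ → Part ℕ := fun n => Nat.rec (f a) (fun y IH => IH.bind fun i =>
      g (Nat.pair a (Nat.pair y i))) n
    change _ ↔ v ∈ G n
    have hG : ∀ y, G (y + 1) = (G y).bind fun i => g (Nat.pair a (Nat.pair y i)) := fun _ => rfl
    constructor
    · rintro ⟨L, ⟨h0, rfl⟩, hs⟩
      have : ∀ y ≤ n, L.getD y 0 ∈ G y := by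
        intro y
        induction y with
        | zero => exact fun _ => h0
        | succ y ih =>
          intro hy
          rw [hG, Part.mem_bind_iff]
          exact ⟨_, ih (by omega), hs y hy⟩
      exact this n le_rfl
    · intro hv
      have : ∀ n v, v ∈ G n → ∃ L : List ℕ, L.length = n + 1 ∧ (L.getD 0 0 ∈ f a ∧
          L.getD n 0 = v) ∧ ∀ y < n, L.getD (y + 1) 0 ∈
            g (Nat.pair a (Nat.pair y (L.getD y 0))) := by
        intro n
        induction n with
        | zero => exact fun v hv => ⟨[v], rfl, ⟨hv, rfl⟩, fun y hy => absurd hy (by simp)⟩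
        | succ n ih =>
          intro v hv
          rw [hG, Part.mem_bind_iff] at hv
          obtain ⟨i, hi, hv⟩ := hv
          obtain ⟨L, hl, ⟨h0, rfl⟩, hs⟩ := ih i hi
          refine ⟨L ++ [v], by simp [hl], ⟨?_, ?_⟩, ?_⟩
          · rwa [List.getD_append _ _ _ _ (by omega)]
          · rw [List.getD_append_right _ _ _ _ (by omega)]; simp [hl]
          · intro y hy
            rw [List.getD_append _ _ _ y (by omega)]
            rcases Nat.lt_succ_iff_lt_or_eq.1 hy with h | rfl
            · rw [List.getD_append _ _ _ _ (by omega)]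
              exact hs y h
            · rw [List.getD_append_right _ _ _ _ (by omega)]
              simpa [hl] using hv
      obtain ⟨L, -, h1, h2⟩ := this n v hv
      exact ⟨L, h1, h2⟩
  | @rfind f _ hf =>
    have : S1 o fun p : ℕ × ℕ => 0 ∈ f (Nat.pair p.1 p.2) ∧ ∀ m < p.2,
        ∃ v : ℕ, v ≠ 0 ∧ v ∈ f (Nat.pair p.1 m) := by
      have h1 : S1 o fun q : (ℕ × ℕ) × ℕ => ∃ v : ℕ, v ≠ 0 ∧ v ∈ f (Nat.pair q.1.1 q.2) := by
        refine Sig.ex (Sig.and (Sig.prim ?_) ?_)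
        · exact PrimrecPred.not (Primrec.eq.comp Primrec.snd (Primrec.const 0))
        · exact hf.comp ((Primrec₂.natPair.comp (Primrec.fst.comp (Primrec.fst.comp Primrec.fst))
            (Primrec.snd.comp Primrec.fst)).pair Primrec.snd)
      exact Sig.and (hf.comp ((Primrec₂.natPair.comp Primrec.fst Primrec.snd).pair
        (Primrec.const 0))) (Sig.all_lt (P := fun _ (x : ℕ × ℕ) m => ∃ v : ℕ, v ≠ 0 ∧
          v ∈ f (Nat.pair x.1 m)) h1 Primrec.snd)
    refine this.of_eq ?_
    rintro - ⟨a, n⟩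
    refine Iff.trans ?_ Nat.mem_rfind.symm
    simp only [Part.map_eq_map, Part.mem_map_iff]
    simp [and_comm]

theorem recursiveIn_res (o : ℕ → ℕ) : Nat.RecursiveIn {fun n => Part.some (o n)}
    fun n => Part.some (Encodable.encode (res o n)) := by
  set O : Set (ℕ →. ℕ) := {fun n => Part.some (o n)}
  have ho : Nat.RecursiveIn O fun n => Part.some (o n) := .oracle _ rfl
  have pr {f : ℕ → ℕ} (hf : Primrec f) : Nat.RecursiveIn O fun n => Part.some (f n) :=
    (Primrec.nat_iff.1 hf).recursiveIn
  let G : ℕ → ℕ := fun m => Encodable.encode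
    (((Encodable.decode (α := List ℕ) m.unpair.1).getD []) ++ [m.unpair.2])
  have hG : Primrec G := Primrec.encode.comp (Primrec.list_concat.comp
    (Primrec.option_getD.comp (Primrec.decode.comp (Primrec.fst.comp Primrec.unpair))
      (Primrec.const [])) (Primrec.snd.comp Primrec.unpair))
  have h1 := (pr hG).comp (.pair (pr (f := fun p => p.unpair.2.unpair.2)
    (Primrec.snd.comp (Primrec.unpair.comp (Primrec.snd.comp Primrec.unpair))))
    (.comp ho (pr (f := fun p => p.unpair.2.unpair.1)
      (Primrec.fst.comp (Primrec.unpair.comp (Primrec.snd.comp Primrec.unpair))))))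
  have h2 := Nat.RecursiveIn.prec (pr (Primrec.const (Encodable.encode ([] : List ℕ)))) h1
  refine (h2.comp (pr (f := fun n => Nat.pair 0 n) (Primrec₂.natPair.comp (Primrec.const 0)
    Primrec.id))).of_eq fun n => ?_
  simp only [Part.bind_eq_bind, Part.bind_some, Nat.unpair_pair]
  induction n with
  | zero => rfl
  | succ n ih =>
    simp only [ih]
    simp [Seq.seq, res_succ, G]

/-- A total function with `Σ⁰₁` graph is recursive in the oracle. -/
theorem recursiveIn_of_comp {o φ : ℕ → ℕ} (h : Comp o φ) :
    Nat.RecursiveIn {fun n => Part.some (o n)} fun n => Part.some (φ n) := by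
  obtain ⟨R, h0, -, h3⟩ := h
  classical
  have h1 : Primrec fun p : List ℕ × ℕ × ℕ => decide (R p.1 p.2) := h0.decide
  set O : Set (ℕ →. ℕ) := {fun n => Part.some (o n)}
  have pr {f : ℕ → ℕ} (hf : Primrec f) : Nat.RecursiveIn O fun n => Part.some (f n) :=
    (Primrec.nat_iff.1 hf).recursiveIn
  -- The search variable codes a candidate value and an oracle length. The subtraction turns success
  -- into `0`, which is what `rfind` looks for.
  let T : ℕ → ℕ := fun m => 1 - Encodable.encode (decide
    (R ((Encodable.decode (α := List ℕ) m.unpair.1).getD [])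
      (m.unpair.2.unpair.1, m.unpair.2.unpair.2.unpair.1)))
  have hT : Primrec T := by
    refine Primrec.nat_sub.comp (Primrec.const 1) (Primrec.encode.comp (h1.comp
      (Primrec.pair (Primrec.option_getD.comp (Primrec.decode.comp (Primrec.fst.comp Primrec.unpair))
      (Primrec.const [])) (Primrec.pair ?_ ?_))))
    · exact Primrec.fst.comp (Primrec.unpair.comp (Primrec.snd.comp Primrec.unpair))
    · exact Primrec.fst.comp (Primrec.unpair.comp (Primrec.snd.comp (Primrec.unpair.comp
        (Primrec.snd.comp Primrec.unpair))))
  have h4 := (pr hT).comp (.pair (.comp (recursiveIn_res o) (pr (f := fun p => p.unpair.2.unpair.2)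
    (Primrec.snd.comp (Primrec.unpair.comp (Primrec.snd.comp Primrec.unpair))))) (pr Primrec.id))
  have h5 := (pr (f := fun p => p.unpair.1) (Primrec.fst.comp Primrec.unpair)).comp h4.rfind
  refine h5.of_eq fun n => ?_
  have hR : ∀ v m, R (res o m) (n, v) → v = φ n := fun v m hv => ((h3 () (n, v)).2 ⟨m, hv⟩).symm
  obtain ⟨m, hm⟩ := (h3 () (n, φ n)).1 rfl
  rw [Part.eq_some_iff]
  simp only [Part.bind_eq_bind]
  refine Part.mem_bind_iff.2 ?_
  simp only [Seq.seq, Part.map_eq_map, Part.bind_some, Part.map_some, Nat.unpair_pair, id,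
    Part.mem_some_iff, T, Encodable.encodek, Option.getD_some]
  have hex : ∃ s : ℕ, R (res o s.unpair.2) (n, s.unpair.1) :=
    ⟨Nat.pair (φ n) m, by simpa using hm⟩
  refine ⟨Nat.find hex, Nat.mem_rfind.2 ⟨?_, ?_⟩, (hR _ _ (Nat.find_spec hex)).symm⟩
  · simp [Nat.find_spec hex]
  · intro s hs
    simp [Nat.find_min hex hs]

theorem setTuringReducible_iff {A B : Set ℕ} :
    SetTuringReducible A B ↔ Comp (B.indicator 1) (A.indicator 1 : ℕ → ℕ) := by
  rw [SetTuringReducible, TuringReducible, RecursiveIn.iff_nat]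
  constructor
  · intro h
    refine (s1_of_recursiveIn h).of_eq fun _ p => ?_
    simp [oracle, eq_comm]
  · exact recursiveIn_of_comp

/-! ### The full binary tree on `ℕ` and its embeddings. -/

/-- The parent of a node of the full binary tree on `ℕ`, where `a` has children `2a+1`, `2a+2`. -/
def par (b : ℕ) : ℕ := (b - 1) / 2

/-- The ancestor relation of the full binary tree on `ℕ`. -/
def Tle (a b : ℕ) : Prop := ∃ m, par^[m] b = a

namespace Tle

theorem refl (a : ℕ) : Tle a a := ⟨0, rfl⟩

theorem trans {a b c : ℕ} : Tle a b → Tle b c → Tle a c := by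
  rintro ⟨m, rfl⟩ ⟨n, rfl⟩
  exact ⟨m + n, by rw [Function.iterate_add_apply]⟩

theorem le {a b : ℕ} : Tle a b → a ≤ b := by
  rintro ⟨m, rfl⟩
  induction m with
  | zero => exact le_rfl
  | succ m ih =>
    rw [Function.iterate_succ_apply']
    refine le_trans ?_ ih
    unfold par; omega

theorem antisymm {a b : ℕ} (h : Tle a b) (h' : Tle b a) : a = b := le_antisymm h.le h'.le

theorem par_self (b : ℕ) : Tle (par b) b := ⟨1, rfl⟩

theorem of_ne {a b : ℕ} (h : Tle a b) (hne : a ≠ b) : Tle a (par b) ∧ 0 < b := by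
  refine ⟨?_, lt_of_le_of_lt (Nat.zero_le a) (lt_of_le_of_ne h.le hne)⟩
  obtain ⟨m, rfl⟩ := h
  cases m with
  | zero => exact absurd rfl hne
  | succ m => exact ⟨m, rfl⟩

theorem par_left (a : ℕ) : par (2 * a + 1) = a := by unfold par; omega

theorem par_right (a : ℕ) : par (2 * a + 2) = a := by unfold par; omega

theorem eq_child {b : ℕ} (h : 0 < b) : b = 2 * par b + 1 ∨ b = 2 * par b + 2 := by
  unfold par; omega

theorem left (a : ℕ) : Tle a (2 * a + 1) := by simpa [par_left] using par_self (2 * a + 1)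

theorem right (a : ℕ) : Tle a (2 * a + 2) := by simpa [par_right] using par_self (2 * a + 2)

theorem zero (b : ℕ) : Tle 0 b := by
  induction b using Nat.strong_induction_on with
  | _ b ih =>
    rcases Nat.eq_zero_or_pos b with rfl | h
    · exact refl _
    · exact (ih (par b) (by unfold par; omega)).trans (par_self b)

theorem total {a b c : ℕ} (h : Tle a c) (h' : Tle b c) : Tle a b ∨ Tle b a := by
  obtain ⟨m, rfl⟩ := h
  obtain ⟨n, rfl⟩ := h'
  rcases le_total m n with h | h
  · right
    exact ⟨n - m, by rw [← Function.iterate_add_apply, Nat.sub_add_cancel h]⟩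
  · left
    exact ⟨m - n, by rw [← Function.iterate_add_apply, Nat.sub_add_cancel h]⟩

theorem child {a b : ℕ} (h : Tle a b) (hne : a ≠ b) : Tle (2 * a + 1) b ∨ Tle (2 * a + 2) b := by
  induction b using Nat.strong_induction_on with
  | _ b ih =>
    obtain ⟨h1, h2⟩ := h.of_ne hne
    by_cases e : a = par b
    · subst e
      rcases eq_child h2 with e | e <;> rw [← e] <;> simp [refl]
    · exact (ih (par b) (by unfold par; omega) h1 e).imp (·.trans (par_self b))
        (·.trans (par_self b))

theorem not_left_right (a : ℕ) : ¬ Tle (2 * a + 1) (2 * a + 2) := by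
  intro h
  have := (h.of_ne (by omega)).1.le
  rw [par_right] at this
  omega

theorem not_right_left (a : ℕ) : ¬ Tle (2 * a + 2) (2 * a + 1) := fun h => by
  have := h.le; omega

/-- Walk from `a` towards the root; the first ancestor of `a` that is also one of `b` is the
branching point. -/
theorem exists_meet {a b : ℕ} (h : ¬ Tle a b) (h' : ¬ Tle b a) :
    ∃ m, (Tle (2 * m + 1) a ∧ Tle (2 * m + 2) b) ∨ (Tle (2 * m + 2) a ∧ Tle (2 * m + 1) b) := by
  induction a using Nat.strong_induction_on with
  | _ a ih =>
    have ha : 0 < a := Nat.pos_of_ne_zero fun e => h (e ▸ zero b)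
    by_cases hp : Tle (par a) b
    · refine ⟨par a, ?_⟩
      have hne : par a ≠ b := fun e => h' (e ▸ par_self a)
      rcases hp.child hne with hb | hb <;> rcases eq_child ha with e | e
      · exact absurd (e ▸ hb) h
      · exact Or.inr ⟨e ▸ refl a, hb⟩
      · exact Or.inl ⟨e ▸ refl a, hb⟩
      · exact absurd (e ▸ hb) h
    · obtain ⟨m, hm⟩ := ih (par a) (by unfold par; omega) hp fun hb => h' (hb.trans (par_self a))
      exact ⟨m, hm.imp (And.imp_left (·.trans (par_self a))) (And.imp_left (·.trans (par_self a)))⟩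

theorem exists_ge (t B : ℕ) : ∃ b, B ≤ b ∧ Tle t b := by
  induction B with
  | zero => exact ⟨t, Nat.zero_le _, refl t⟩
  | succ B ih =>
    obtain ⟨b, hb, h⟩ := ih
    exact ⟨2 * b + 1, by omega, h.trans (left b)⟩

end Tle

theorem primrec_par : Primrec par :=
  Primrec.nat_div2.comp Primrec.pred |>.of_eq fun n => by simp [par, Nat.div2_val]

theorem primrecRel_tle : PrimrecRel Tle := by
  have h1 : PrimrecRel fun (m : ℕ) (p : ℕ × ℕ) => par^[m] p.2 = p.1 :=
    Primrec.eq.comp (Primrec.nat_iterate Primrec.fst (Primrec.snd.comp Primrec.snd)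
      (primrec_par.comp Primrec.snd)) (Primrec.fst.comp Primrec.snd)
  -- The number of steps can be bounded by the node itself because `par` strictly decreases positive
  -- nodes.
  have h2 : PrimrecPred fun p : ℕ × ℕ => ∃ m < p.2 + 1, par^[m] p.2 = p.1 :=
    (h1.exists_mem_list.comp (Primrec.list_range.comp (Primrec.succ.comp Primrec.snd))
      Primrec.id).of_eq fun p => by simp
  refine h2.of_eq ?_
  rintro ⟨a, b⟩
  constructor
  · rintro ⟨m, -, h⟩
    exact ⟨m, h⟩
  · have : ∀ b, ∃ m < b + 1, par^[m] b = a ∨ ¬ Tle a b := by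
      intro b
      induction b using Nat.strong_induction_on with
      | _ b ih =>
        by_cases e : a = b
        · exact ⟨0, by simp, Or.inl e.symm⟩
        by_cases h : Tle a b
        · obtain ⟨h1, h2⟩ := h.of_ne e
          obtain ⟨m, hm, h⟩ := ih (par b) (by unfold par; omega)
          refine ⟨m + 1, ?_, Or.inl (h.resolve_right (not_not.2 h1))⟩
          unfold par at hm; omega
        · exact ⟨0, by simp, Or.inr h⟩
    intro h
    obtain ⟨m, hm, h'⟩ := this b
    exact ⟨m, hm, h'.resolve_right (not_not.2 h)⟩

/-- `k` is a tree embedding on the nodes `a < N` and their children. -/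
def FinEmb (N : ℕ) (k : ℕ → ℕ) : Prop :=
  ∀ a < N, Tle (k a) (k (2 * a + 1)) ∧ Tle (k a) (k (2 * a + 2)) ∧
    ¬ Tle (k (2 * a + 1)) (k (2 * a + 2)) ∧ ¬ Tle (k (2 * a + 2)) (k (2 * a + 1))

theorem FinEmb.mono {N : ℕ} {k : ℕ → ℕ} (hk : FinEmb N k) {a b : ℕ} (hb : b ≤ 2 * N)
    (h : Tle a b) : Tle (k a) (k b) := by
  induction b using Nat.strong_induction_on with
  | _ b ih =>
    by_cases e : a = b
    · subst e; exact Tle.refl _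
    · obtain ⟨h1, h2⟩ := h.of_ne e
      refine (ih (par b) (by unfold par; omega) (by unfold par; omega) h1).trans ?_
      have := hk (par b) (by unfold par; omega)
      rcases Tle.eq_child h2 with e | e <;> rw [← e] at this
      · exact this.1
      · exact this.2.1

/-- If `a` is not an ancestor of `b`, then either `b` is a proper ancestor of `a` or the two branch
at some `m`. In both cases comparable images of `a` and `b` would make the images of two siblings
comparable. -/
theorem FinEmb.reflect {N : ℕ} {k : ℕ → ℕ} (hk : FinEmb N k) {a b : ℕ} (ha : a ≤ 2 * N)
    (hb : b ≤ 2 * N) (h : Tle (k a) (k b)) : Tle a b := by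
  by_contra hab
  by_cases hba : Tle b a
  · have hne : b ≠ a := fun e => hab (e ▸ Tle.refl a)
    rcases hba.child hne with hc | hc
    · have hl := hc.le
      have := hk b (by omega)
      exact this.2.2.1 (((hk.mono ha hc).trans h).trans this.2.1)
    · have hl := hc.le
      have := hk b (by omega)
      exact this.2.2.2 (((hk.mono ha hc).trans h).trans this.1)
  · obtain ⟨m, ⟨h1, h2⟩ | ⟨h1, h2⟩⟩ := Tle.exists_meet hab hba
    all_goals
      have hl := h1.le
      have := hk m (by omega)
      rcases ((hk.mono ha h1).trans h).total (hk.mono hb h2) with hc | hc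
    · exact this.2.2.1 hc
    · exact this.2.2.2 hc
    · exact this.2.2.2 hc
    · exact this.2.2.1 hc

/-- `k` is an embedding of the full binary tree on `ℕ` into itself. -/
def Emb (k : ℕ → ℕ) : Prop := ∀ N, FinEmb N k

namespace Emb

variable {k l : ℕ → ℕ}

theorem iff (hk : Emb k) {a b : ℕ} : Tle (k a) (k b) ↔ Tle a b :=
  ⟨(hk (a + b)).reflect (by omega) (by omega), (hk b).mono (by omega)⟩

theorem of_iff (h : ∀ a b, Tle (k a) (k b) ↔ Tle a b) : Emb k := fun _ a _ =>
  ⟨(h _ _).2 (Tle.left a), (h _ _).2 (Tle.right a), (h _ _).not.2 (Tle.not_left_right a),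
    (h _ _).not.2 (Tle.not_right_left a)⟩

theorem inj (hk : Emb k) : Function.Injective k := fun _ _ h =>
  Tle.antisymm (hk.iff.1 (h ▸ Tle.refl _)) (hk.iff.1 (h ▸ Tle.refl _))

theorem id : Emb id := of_iff fun _ _ => Iff.rfl

theorem comp (hk : Emb k) (hl : Emb l) : Emb (k ∘ l) := of_iff fun _ _ => hk.iff.trans hl.iff

theorem ge (hk : Emb k) {N : ℕ} (h : ∀ a < N, k a = a) {b : ℕ} (hb : N ≤ b) : N ≤ k b := by
  by_contra hc
  push Not at hc
  have := hk.inj (h _ hc)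
  omega

/-- Passing from `par a` to `a`, the image moves at least to a child, so `k a ≥ 2 * k (par a) + 1`.
The bound makes the range of `k` decidable from `k`. -/
theorem le_two_mul (hk : Emb k) (a : ℕ) : a ≤ 2 * k a := by
  induction a using Nat.strong_induction_on with
  | _ a ih =>
    rcases Nat.eq_zero_or_pos a with rfl | h
    · exact Nat.zero_le _
    have h1 := ih (par a) (by unfold par; omega)
    have h2 : Tle (k (par a)) (k a) := hk.iff.2 (Tle.par_self a)
    have h3 : k (par a) ≠ k a := fun e => by
      have := hk.inj e
      unfold par at this; omega
    have h4 : 2 * k (par a) + 1 ≤ k a := by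
      rcases h2.child h3 with h | h
      · exact h.le
      · have := h.le; omega
    unfold par at h1 h4
    omega

end Emb

/-! ### Strings as nodes of the tree. -/

/-- The numbering of strings by nodes of the full binary tree on `ℕ`. -/
def num (s : BinStr) : ℕ := s.foldl (fun n b => 2 * n + 1 + Encodable.encode b) 0

theorem num_concat (s : BinStr) (b : Bool) : num (s ++ [b]) = 2 * num s + 1 + Encodable.encode b := by
  simp [num]

theorem primrec_num : Primrec num := by
  refine Primrec.list_foldl (f := fun s : BinStr => s)
    (h := fun _ p => 2 * p.1 + 1 + Encodable.encode p.2) Primrec.id (Primrec.const 0) ?_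
  exact Primrec.nat_add.comp (Primrec.nat_add.comp (Primrec.nat_mul.comp (Primrec.const 2)
    (Primrec.fst.comp Primrec.snd)) (Primrec.const 1))
    (Primrec.encode.comp (Primrec.snd.comp Primrec.snd))

theorem tle_num_iff {s t : BinStr} : Tle (num s) (num t) ↔ s <+: t := by
  have hpar : ∀ (t : BinStr) b, par (num (t ++ [b])) = num t := by
    intro t b
    rw [num_concat]
    cases b
    · exact Tle.par_left _
    · exact Tle.par_right _
  have hlen : ∀ t : BinStr, Tle (num t) (num ([] : BinStr)) → t = [] := by
    intro t ht
    rcases List.eq_nil_or_concat' t with rfl | ⟨t, b, rfl⟩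
    · rfl
    · have := ht.le
      rw [num_concat] at this
      simp [num] at this
  -- The induction is on the sum of the lengths because the case of equal numbers needs the
  -- hypothesis in both directions.
  have key : ∀ n (s t : BinStr), s.length + t.length ≤ n → (Tle (num s) (num t) ↔ s <+: t) := by
    intro n
    induction n with
    | zero =>
      intro s t h
      have hs : s = [] := List.length_eq_zero_iff.1 (by omega)
      subst hs
      exact ⟨fun _ => List.nil_prefix, fun _ => Tle.zero _⟩
    | succ n ih =>
      intro s t h
      rcases List.eq_nil_or_concat' t with rfl | ⟨t, b, rfl⟩
      · rw [List.prefix_nil]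
        exact ⟨hlen s, fun e => e ▸ Tle.refl _⟩
      · rw [List.prefix_concat_iff]
        simp only [List.length_append, List.length_singleton] at h
        constructor
        · intro hst
          by_cases e : num s = num (t ++ [b])
          · rcases List.eq_nil_or_concat' s with rfl | ⟨s, c, rfl⟩
            · exact Or.inr List.nil_prefix
            have e' : num s = num t := by rw [← hpar s c, e, hpar]
            simp only [List.length_append, List.length_singleton] at h
            have h1 := (ih s t (by omega)).1 (e' ▸ Tle.refl _)
            have h2 := (ih t s (by omega)).1 (e' ▸ Tle.refl _)
            obtain rfl := List.IsPrefix.eq_of_length_le h1 h2.length_le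
            rw [num_concat, num_concat] at e
            obtain rfl := Encodable.encode_injective (Nat.add_left_cancel e)
            exact Or.inl rfl
          · right
            have := (hst.of_ne e).1
            rw [hpar] at this
            exact (ih s t (by omega)).1 this
        · rintro (rfl | hst)
          · exact Tle.refl _
          · have := (ih s t (by omega)).2 hst
            rw [← hpar t b] at this
            exact this.trans (Tle.par_self _)
  exact key _ s t le_rfl

theorem num_injective : Function.Injective num := fun s t h => by
  have h1 : s <+: t := tle_num_iff.1 (h ▸ Tle.refl _)
  have h2 : t <+: s := tle_num_iff.1 (h ▸ Tle.refl _)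
  exact h1.eq_of_length_le h2.length_le

theorem num_surjective : Function.Surjective num := by
  intro a
  induction a using Nat.strong_induction_on with
  | _ a ih =>
    rcases Nat.eq_zero_or_pos a with rfl | h
    · exact ⟨[], rfl⟩
    obtain ⟨s, hs⟩ := ih (par a) (by unfold par; omega)
    rcases Tle.eq_child h with e | e
    · exact ⟨s ++ [false], by rw [num_concat, hs]; simpa using e.symm⟩
    · exact ⟨s ++ [true], by rw [num_concat, hs]; simpa using e.symm⟩

/-! ### Dense color patterns and thinning. -/

/-- The set `S` meets every cone above a node extending `t`. -/
def DenseAbove (S : ℕ → Prop) (t : ℕ) : Prop := ∀ u, Tle t u → ∃ v, Tle u v ∧ S v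

/-- Otherwise the values of `g` could be excluded one after another by passing to higher nodes,
until none is left. -/
theorem exists_denseAbove_of_finite {α : Type*} [Finite α] (g : ℕ → α) (t : ℕ) :
    ∃ t', Tle t t' ∧ ∃ a, DenseAbove (fun v => g v = a) t' := by
  classical
  have := Fintype.ofFinite α
  by_contra hc
  simp only [DenseAbove] at hc
  push Not at hc
  have key : ∀ S : Finset α, ∃ u, Tle t u ∧ ∀ v, Tle u v → g v ∉ S := by
    intro S
    induction S using Finset.induction_on with
    | empty => exact ⟨t, Tle.refl t, by simp⟩
    | insert a S _ ih =>
      obtain ⟨u, hu, h⟩ := ih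
      obtain ⟨w, hw, h'⟩ := hc u hu a
      refine ⟨w, hu.trans hw, fun v hv => ?_⟩
      rw [Finset.mem_insert, not_or]
      exact ⟨h' v hv, h v (hw.trans hv)⟩
  obtain ⟨u, -, h⟩ := key Finset.univ
  exact h u (Tle.refl u) (Finset.mem_univ _)

/-- The finite-valued map is the vector of colors seen from all `s ≤ t`, which include the ancestors
of `t`. -/
theorem exists_denseAbove {c : ℕ → ℕ → ℕ} {r : ℕ} (hr : ∀ a b, c a b < r) (t : ℕ) :
    ∃ t', Tle t t' ∧ ∃ α : ℕ → ℕ, (∀ s, α s < r) ∧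
      DenseAbove (fun v => ∀ s ≤ t, c s v = α s) t' := by
  obtain ⟨t', h, g, hg⟩ := exists_denseAbove_of_finite
    (fun v (s : Fin (t + 1)) => (⟨c s v, hr s v⟩ : Fin r)) t
  refine ⟨t', h, fun s => if hs : s < t + 1 then g ⟨s, hs⟩ else 0, fun s => ?_, fun u hu => ?_⟩
  · dsimp only
    split_ifs
    · exact (g _).2
    · exact (Nat.zero_le _).trans_lt (hr 0 0)
  · obtain ⟨v, hv, e⟩ := hg u hu
    refine ⟨v, hv, fun s hs => ?_⟩
    have := congrArg Fin.val (congrFun e ⟨s, by omega⟩)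
    simpa [Nat.lt_succ_of_le hs] using this

theorem Tle.not_of_le {x y x' y' : ℕ} (h : ¬ Tle x y) (h' : ¬ Tle y x) (hx : Tle x x')
    (hy : Tle y y') : ¬ Tle x' y' := fun hc =>
  ((hx.trans hc).total hy).elim h h'

theorem getD_res {g : ℕ → ℕ} {n a : ℕ} (h : a < n) : (res g n).getD a 0 = g a := by
  rw [List.getD, getElem?_res, if_pos h, Option.getD_some]

/-- Extending a finite embedding to a full one on which finitely many colorings are constant. -/
theorem exists_thinning {o : ℕ → ℕ} {c : ℕ → ℕ → ℕ} (hc : Comp o fun p : ℕ × ℕ => c p.1 p.2) {N : ℕ}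
    {k col : ℕ → ℕ} (hk : FinEmb N k) (hd : ∀ t, N ≤ t → t ≤ 2 * N →
      DenseAbove (fun v => ∀ a < N, Tle a t → c (k a) v = col a) (k t)) :
    ∃ K, Comp o K ∧ Emb K ∧ (∀ a < N, K a = k a) ∧
      ∀ a < N, ∀ b ≥ N, Tle a b → c (K a) (K b) = col a := by
  set κ := res k (2 * N + 1) with hκ
  set γ := res col N with hγ
  have eκ : ∀ a ≤ 2 * N, κ.getD a 0 = k a := fun a ha => getD_res (by omega)
  have eγ : ∀ a < N, γ.getD a 0 = col a := fun a ha => getD_res ha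
  let good : ℕ → ℕ → Prop := fun b v => ∀ a < N, Tle a b → c (κ.getD a 0) v = γ.getD a 0
  have hgood : ∀ b v, (∀ a < N, Tle a b → c (k a) v = col a) → good b v := fun b v h a ha hab => by
    rw [eκ a (by omega), eγ a ha]; exact h a ha hab
  -- The rule for the value at `b = L.length`: prescribed for `b < N`; above `k b` for a leaf `N ≤ b
  -- ≤ 2N` of the finite tree; later, above a child of the value at `par b`. The difference `b - 2 *
  -- par b` is `1` or `2` and selects the side.
  let A : List ℕ → ℕ → Prop := fun L v =>
    (L.length < N ∧ v = κ.getD L.length 0) ∨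
    (N ≤ L.length ∧ (if L.length ≤ 2 * N then Tle (κ.getD L.length 0) v else
      Tle (2 * L.getD (par L.length) 0 + (L.length - 2 * par L.length)) v) ∧ good L.length v)
  have hA : S1 o fun p : List ℕ × ℕ => A p.1 p.2 := by
    have l : Primrec fun p : List ℕ × ℕ => p.1.length := Primrec.list_length.comp Primrec.fst
    have κl : Primrec fun p : List ℕ × ℕ => κ.getD p.1.length 0 :=
      (Primrec.list_getD 0).comp (Primrec.const κ) l
    have h1 : PrimrecPred fun p : List ℕ × ℕ => p.1.length ≤ 2 * N :=
      Primrec.nat_le.comp l (Primrec.const _)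
    have h2 : PrimrecPred fun p : List ℕ × ℕ => Tle (κ.getD p.1.length 0) p.2 :=
      primrecRel_tle.comp κl Primrec.snd
    have h3 : PrimrecPred fun p : List ℕ × ℕ =>
        Tle (2 * p.1.getD (par p.1.length) 0 + (p.1.length - 2 * par p.1.length)) p.2 := by
      refine primrecRel_tle.comp (Primrec.nat_add.comp ?_ ?_) Primrec.snd
      · exact Primrec.nat_mul.comp (Primrec.const 2) ((Primrec.list_getD 0).comp Primrec.fst
          (primrec_par.comp l))
      · exact Primrec.nat_sub.comp l (Primrec.nat_mul.comp (Primrec.const 2) (primrec_par.comp l))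
    refine Sig.or (Sig.prim ?_) (Sig.and (Sig.prim ?_) (Sig.and (Sig.prim ?_) ?_))
    · exact (Primrec.nat_lt.comp l (Primrec.const N)).and (Primrec.eq.comp Primrec.snd κl)
    · exact Primrec.nat_le.comp (Primrec.const N) l
    · refine ((h1.and h2).or (h1.not.and h3)).of_eq fun p => ?_
      split_ifs with h <;> simp [h]
    · refine Sig.all_lt (Sig.imp_prim ?_ ?_) (Primrec.const N)
      · exact Sig.comp hc (((((Primrec.list_getD 0).comp (Primrec.const κ) Primrec.snd)).pair
          (Primrec.snd.comp Primrec.fst)).pair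
          ((Primrec.list_getD 0).comp (Primrec.const γ) Primrec.snd))
      · exact primrecRel_tle.comp Primrec.snd (l.comp Primrec.fst)
  -- Every value chosen from `N` on lies above the image of a leaf, where `hd` provides further
  -- nodes of the right colors.
  let Inv : List ℕ → Prop := fun L => ∀ i < L.length, N ≤ i →
    ∃ t, N ≤ t ∧ t ≤ 2 * N ∧ Tle t i ∧ Tle (k t) (L.getD i 0)
  have hpar : ∀ b, 2 * N < b → N ≤ par b ∧ par b < b := fun b hb => by unfold par; omega
  have hchild : ∀ u b, 2 * N < b → Tle u (2 * u + (b - 2 * par b)) := by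
    intro u b hb
    rcases Tle.eq_child (b := b) (by omega) with e | e
    · rw [show b - 2 * par b = 1 by omega]; exact Tle.left u
    · rw [show b - 2 * par b = 2 by omega]; exact Tle.right u
  -- The ancestors of `b` below `N` are already ancestors of the leaf `t`.
  have htransfer : ∀ t b v, N ≤ t → Tle t b → (∀ a < N, Tle a t → c (k a) v = col a) →
      good b v := by
    intro t b v ht htb h
    refine hgood b v fun a ha hab => h a ha ?_
    rcases hab.total htb with h' | h'
    · exact h'
    · exact absurd h'.le (by omega)
  obtain ⟨K, hK, hKA⟩ := hA.dependent_choice (Inv := Inv) (by intro i hi; simp at hi)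
    (by
      intro L hL
      by_cases h1 : L.length < N
      · exact ⟨_, Or.inl ⟨h1, rfl⟩⟩
      push Not at h1
      by_cases h2 : L.length ≤ 2 * N
      · obtain ⟨v, hv, h⟩ := hd _ h1 h2 _ (Tle.refl _)
        refine ⟨v, Or.inr ⟨h1, ?_, hgood _ _ h⟩⟩
        rwa [if_pos h2, eκ _ h2]
      · obtain ⟨h3, h4⟩ := hpar L.length (by omega)
        obtain ⟨t, ht, ht', hti, hkt⟩ := hL _ h4 h3
        obtain ⟨v, hv, h⟩ := hd t ht ht' _ (hkt.trans (hchild _ L.length (by omega)))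
        refine ⟨v, Or.inr ⟨h1, ?_, htransfer t _ v ht (hti.trans (Tle.par_self _)) h⟩⟩
        rwa [if_neg h2])
    (by
      intro L v hL hA i hi hN
      simp only [List.length_append, List.length_singleton] at hi
      rcases Nat.lt_succ_iff_lt_or_eq.1 hi with h | rfl
      · rw [List.getD_append _ _ _ _ h]
        exact hL i h hN
      rw [List.getD_append_right _ _ _ _ le_rfl]
      simp only [Nat.sub_self, List.getD_cons_zero]
      rcases hA with ⟨h, -⟩ | ⟨-, h, -⟩
      · omega
      split_ifs at h with h2
      · rw [eκ _ h2] at h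
        exact ⟨_, hN, h2, Tle.refl _, h⟩
      · obtain ⟨h3, h4⟩ := hpar L.length (by omega)
        obtain ⟨t, ht, ht', hti, hkt⟩ := hL _ h4 h3
        exact ⟨t, ht, ht', hti.trans (Tle.par_self _),
          (hkt.trans (hchild _ L.length (by omega))).trans h⟩)
  have K1 : ∀ a < N, K a = k a := by
    intro a ha
    rcases (hKA a).2 with ⟨-, h⟩ | ⟨h, -⟩
    · rw [h, length_res, eκ a (by omega)]
    · rw [length_res] at h; omega
  have K2 : ∀ b, b ≤ 2 * N → Tle (k b) (K b) := by
    intro b hb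
    rcases (hKA b).2 with ⟨h, -⟩ | ⟨-, h, -⟩
    · rw [length_res] at h; rw [K1 b h]; exact Tle.refl _
    · rw [length_res, if_pos hb, eκ b hb] at h; exact h
  have K3 : ∀ b, 2 * N < b → Tle (2 * K (par b) + (b - 2 * par b)) (K b) := by
    intro b hb
    rcases (hKA b).2 with ⟨h, -⟩ | ⟨-, h, -⟩
    · rw [length_res] at h; omega
    · rwa [length_res, if_neg (by omega), getD_res (hpar b hb).2] at h
  refine ⟨K, hK, ?_, K1, ?_⟩
  · intro _ a _
    by_cases ha : a < N
    · obtain ⟨e1, e2, e3, e4⟩ := hk a ha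
      have f1 := K2 (2 * a + 1) (by omega)
      have f2 := K2 (2 * a + 2) (by omega)
      rw [K1 a ha]
      exact ⟨e1.trans f1, e2.trans f2, Tle.not_of_le e3 e4 f1 f2, Tle.not_of_le e4 e3 f2 f1⟩
    · have f1 := K3 (2 * a + 1) (by omega)
      have f2 := K3 (2 * a + 2) (by omega)
      rw [Tle.par_left, Nat.add_sub_cancel_left] at f1
      rw [Tle.par_right, Nat.add_sub_cancel_left] at f2
      have e3 := Tle.not_left_right (K a)
      have e4 := Tle.not_right_left (K a)
      exact ⟨(Tle.left _).trans f1, (Tle.right _).trans f2, Tle.not_of_le e3 e4 f1 f2,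
        Tle.not_of_le e4 e3 f2 f1⟩
  · intro a ha b hb hab
    rcases (hKA b).2 with ⟨h, -⟩ | ⟨-, -, h⟩
    · rw [length_res] at h; omega
    · rw [length_res] at h
      have := h a ha hab
      rwa [eκ a (by omega), eγ a ha, ← K1 a ha] at this

/-! ### The notion of forcing. -/

/-- A forcing condition: a reservoir `j` with a coloring `c` pulled back along `j`, such that the
colors of the nodes below `N` have been decided. -/
structure Cond (z : ℕ → ℕ) (Γ : ℕ → Prop) where
  o : ℕ → ℕ
  j : ℕ → ℕ
  c : ℕ → ℕ → ℕ
  r : ℕ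
  N : ℕ
  not_s1 : ¬ S1 o Γ
  comp_z : Comp o z
  emb : Emb j
  comp_j : Comp o j
  comp_c : Comp o fun p : ℕ × ℕ => c p.1 p.2
  lt_r : ∀ a b, c a b < r
  stable : ∀ a < N, ∃ col, ∀ b ≥ N, Tle a b → c a b = col

namespace Cond

variable {z : ℕ → ℕ} {Γ : ℕ → Prop}

/-- The embeddings that meet the promises of the condition `p`. -/
def gen (p : Cond z Γ) : Set (ℕ → ℕ) := {i | ∃ K, Emb K ∧ (∀ a < p.N, K a = a) ∧ i = p.j ∘ K ∧
  ∀ a, ∃ col B, ∀ b ≥ B, Tle a b → p.c (K a) (K b) = col}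

/-- `K` witnesses that `p'` extends `p`. -/
structure Ext (p' p : Cond z Γ) (K : ℕ → ℕ) : Prop where
  emb : Emb K
  fix : ∀ a < p.N, K a = a
  j_eq : p'.j = p.j ∘ K
  le : p.N ≤ p'.N
  -- An extension may refine the coloring, so only equality of colors is transferred.
  refine_c : ∀ a b b', p'.c a b = p'.c a b' → p.c (K a) (K b) = p.c (K a) (K b')

theorem Ext.refl (p : Cond z Γ) : Ext p p id :=
  ⟨Emb.id, fun _ _ => rfl, rfl, le_rfl, fun _ _ _ h => h⟩

theorem Ext.trans {p q s : Cond z Γ} {K L : ℕ → ℕ} (h : Ext q p K) (h' : Ext s q L) :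
    Ext s p (K ∘ L) where
  emb := h.emb.comp h'.emb
  fix a ha := by rw [Function.comp_apply, h'.fix a (ha.trans_le h.le), h.fix a ha]
  j_eq := by rw [h'.j_eq, h.j_eq]; rfl
  le := h.le.trans h'.le
  refine_c a b b' e := h.refine_c _ _ _ (h'.refine_c _ _ _ e)

theorem lt_r_pos (p : Cond z Γ) : 0 < p.r := (Nat.zero_le _).trans_lt (p.lt_r 0 0)

/-- Thinning out the reservoir of a condition. -/
theorem exists_ext (p : Cond z Γ) {N : ℕ} (hN : p.N ≤ N) {k col : ℕ → ℕ} (hk : FinEmb N k)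
    (hfix : ∀ a < p.N, k a = a) (hd : ∀ t, N ≤ t → t ≤ 2 * N →
      DenseAbove (fun v => ∀ a < N, Tle a t → p.c (k a) v = col a) (k t)) :
    ∃ (p' : Cond z Γ) (K : ℕ → ℕ), Ext p' p K ∧ p'.N = N ∧ ∀ a < N, K a = k a := by
  obtain ⟨K, hK, hE, h1, h2⟩ := exists_thinning p.comp_c hk hd
  refine ⟨⟨p.o, p.j ∘ K, fun a b => p.c (K a) (K b), p.r, N, p.not_s1, p.comp_z, p.emb.comp hE,
    Comp.comp (F := p.j) p.comp_j hK, ?_, fun a b => p.lt_r _ _, fun a ha => ⟨col a, h2 a ha⟩⟩, K, ⟨hE, ?_, rfl,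
    hN, fun _ _ _ h => h⟩, rfl, h1⟩
  · exact Comp.comp (F := fun q : ℕ × ℕ => p.c q.1 q.2) (G := fun q : ℕ × ℕ => (K q.1, K q.2))
      p.comp_c (Comp.pair (Comp.comp hK (Comp.of_primrec Primrec.fst))
        (Comp.comp hK (Comp.of_primrec Primrec.snd)))
  · exact fun a ha => (h1 a (ha.trans_le hN)).trans (hfix a ha)

/-- To decide the color of the node `N` itself, its two children are moved above a node `t'` above
which one color pattern is dense. The nodes up to `2N` stay in place. -/
theorem exists_ext_succ (p : Cond z Γ) : ∃ (p' : Cond z Γ) (K : ℕ → ℕ), Ext p' p K ∧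
    p'.N = p.N + 1 := by
  set N := p.N with hN
  obtain ⟨t', ht', α, -, hα⟩ := exists_denseAbove p.lt_r N
  choose! col hcol using p.stable
  let k : ℕ → ℕ := fun b => if b = 2 * N + 1 then 2 * t' + 1 else
    if b = 2 * N + 2 then 2 * t' + 2 else b
  have k1 : k (2 * N + 1) = 2 * t' + 1 := by simp [k]
  have k2 : k (2 * N + 2) = 2 * t' + 2 := by simp [k]
  have k3 : ∀ b ≤ 2 * N, k b = b := fun b hb => by
    simp only [k]; rw [if_neg (by omega), if_neg (by omega)]
  have hk : FinEmb (N + 1) k := by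
    intro a ha
    rw [k3 a (by omega)]
    rcases Nat.lt_succ_iff_lt_or_eq.1 ha with h | rfl
    · rw [k3 (2 * a + 1) (by omega), k3 (2 * a + 2) (by omega)]
      exact ⟨Tle.left a, Tle.right a, Tle.not_left_right a, Tle.not_right_left a⟩
    · rw [k1, k2]
      exact ⟨ht'.trans (Tle.left _), ht'.trans (Tle.right _), Tle.not_left_right _,
        Tle.not_right_left _⟩
  obtain ⟨p', K, h, h', -⟩ := p.exists_ext (N := N + 1) (k := k)
    (col := fun a => if a < N then col a else α N) (by omega) hk (fun a ha => k3 a (by omega)) (by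
      intro t ht h2 u hu
      by_cases h3 : t ≤ 2 * N
      · rw [k3 t h3] at hu
        refine ⟨u, Tle.refl u, fun a ha hat => ?_⟩
        -- The descendants of `N` other than `N` start at `2N + 1`, so a leaf `t ≤ 2N` only sees
        -- colors decided before.
        have hne : a < N := by
          by_contra hc
          obtain rfl : a = N := by omega
          rcases hat.child (by omega) with h | h
          · have := h.le; omega
          · have := h.le; omega
        rw [if_pos hne, k3 a (by omega)]
        exact hcol a hne u (by have := hu.le; omega) (hat.trans hu)
      · have hp : par t = N := by unfold par; omega
        have hkt : Tle t' (k t) := by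
          rcases (show t = 2 * N + 1 ∨ t = 2 * N + 2 by omega) with rfl | rfl
          · rw [k1]; exact Tle.left _
          · rw [k2]; exact Tle.right _
        obtain ⟨v, hv, hs⟩ := hα u (hkt.trans hu)
        refine ⟨v, hv, fun a ha hat => ?_⟩
        have hNv : Tle N v := ((ht'.trans hkt).trans hu).trans hv
        rw [k3 a (by omega)]
        split_ifs with h4
        · have := (hat.of_ne (by omega)).1
          rw [hp] at this
          exact hcol a h4 v hNv.le (this.trans hNv)
        · rw [show a = N by omega]
          exact hs N le_rfl)
  exact ⟨p', K, h, h'⟩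

end Cond

/-! ### The forcing question and its two answers. -/

theorem FinEmb.congr {N : ℕ} {k k' : ℕ → ℕ} (h : ∀ a ≤ 2 * N, k a = k' a) (hk : FinEmb N k) :
    FinEmb N k' := by
  intro a ha
  rw [← h a (by omega), ← h (2 * a + 1) (by omega), ← h (2 * a + 2) (by omega)]
  exact hk a ha

theorem primrecPred_finEmb : PrimrecPred fun p : ℕ × List ℕ =>
    FinEmb p.1 fun a => p.2.getD a 0 := by
  have g : ∀ {f : ℕ → ℕ}, Primrec f → Primrec fun p : ℕ × List ℕ => p.2.getD (f p.1) 0 :=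
    fun hf => (Primrec.list_getD 0).comp Primrec.snd (hf.comp Primrec.fst)
  have dbl : Primrec fun a : ℕ => 2 * a := Primrec.nat_mul.comp (Primrec.const 2) Primrec.id
  have g0 := g Primrec.id
  have g1 := g (Primrec.nat_add.comp dbl (Primrec.const 1))
  have g2 := g (Primrec.nat_add.comp dbl (Primrec.const 2))
  have h : PrimrecRel fun (a : ℕ) (σ : List ℕ) =>
      Tle (σ.getD a 0) (σ.getD (2 * a + 1) 0) ∧ Tle (σ.getD a 0) (σ.getD (2 * a + 2) 0) ∧
        ¬ Tle (σ.getD (2 * a + 1) 0) (σ.getD (2 * a + 2) 0) ∧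
        ¬ Tle (σ.getD (2 * a + 2) 0) (σ.getD (2 * a + 1) 0) :=
    (primrecRel_tle.comp g0 g1).and ((primrecRel_tle.comp g0 g2).and
      ((primrecRel_tle.comp g1 g2).not.and (primrecRel_tle.comp g2 g1).not))
  exact (h.forall_mem_list.comp (Primrec.list_range.comp Primrec.fst) Primrec.snd).of_eq
    fun p => by simp [FinEmb]

namespace Cond

variable {z : ℕ → ℕ} {Γ : ℕ → Prop}

/-- Some finite embedding respecting the coloring `d` forces `R` to hold of `x`. -/
def Forces (p : Cond z Γ) (R : List ℕ → ℕ → Prop) (d : ℕ → ℕ) (x : ℕ) : Prop :=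
  ∃ w : ℕ × List ℕ × List ℕ × List ℕ,
    (p.N ≤ w.1 ∧ (∀ a < p.N, w.2.1.getD a 0 = a) ∧ FinEmb w.1 fun a => w.2.1.getD a 0) ∧
    (∀ a < w.1, ∀ t < 2 * w.1 + 1, (p.N ≤ a ∧ w.1 ≤ t ∧ Tle a t) →
      d (Nat.pair (w.2.1.getD a 0) (w.2.1.getD t 0)) = w.2.2.1.getD a 0) ∧
    (w.2.2.2.length = w.1 ∧ R w.2.2.2 x) ∧
      ∀ a < w.1, z a = (w.2.2.2.getD a 0).unpair.1 ∧
        p.j (w.2.1.getD a 0) = (w.2.2.2.getD a 0).unpair.2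

/-- A witness is finite, and checking it takes finitely many values of `z`, `j` and `d`. This brings
`Forces` within reach of the compactness results. -/
theorem sig_forces (p : Cond z Γ) {R : List ℕ → ℕ → Prop} (hR : PrimrecRel R) :
    Sig (fun d => pr p.o d) (p.Forces R) := by
  have ho : Sig (fun d => pr p.o d) fun _ (q : ℕ × ℕ) => p.o q.1 = q.2 :=
    Sig.pr_left (fun _ => p.o) fun d => d
  have hd : Sig (fun d => pr p.o d) fun d (q : ℕ × ℕ) => d q.1 = q.2 :=
    Sig.pr_right (fun _ => p.o) fun d => d
  have hz : Sig (fun d => pr p.o d) fun _ (q : ℕ × ℕ) => z q.1 = q.2 := p.comp_z.sig ho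
  have hj : Sig (fun d => pr p.o d) fun _ (q : ℕ × ℕ) => p.j q.1 = q.2 := p.comp_j.sig ho
  have wN : Primrec fun q : ℕ × (ℕ × List ℕ × List ℕ × List ℕ) => q.2.1 :=
    Primrec.fst.comp Primrec.snd
  have wκ : Primrec fun q : ℕ × (ℕ × List ℕ × List ℕ × List ℕ) => q.2.2.1 :=
    Primrec.fst.comp (Primrec.snd.comp Primrec.snd)
  have wε : Primrec fun q : ℕ × (ℕ × List ℕ × List ℕ × List ℕ) => q.2.2.2.1 :=
    Primrec.fst.comp (Primrec.snd.comp (Primrec.snd.comp Primrec.snd))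
  have wτ : Primrec fun q : ℕ × (ℕ × List ℕ × List ℕ × List ℕ) => q.2.2.2.2 :=
    Primrec.snd.comp (Primrec.snd.comp (Primrec.snd.comp Primrec.snd))
  refine Sig.ex (Sig.and (Sig.and (Sig.prim ?_) (Sig.and ?_ (Sig.prim ?_))) (Sig.and ?_
    (Sig.and (Sig.and (Sig.prim ?_) (Sig.prim ?_)) ?_)))
  · exact Primrec.nat_le.comp (Primrec.const _) wN
  · exact Sig.all_lt (Sig.prim (Primrec.eq.comp ((Primrec.list_getD 0).comp
      (wκ.comp Primrec.fst) Primrec.snd) Primrec.snd)) (Primrec.const p.N)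
  · exact primrecPred_finEmb.comp (wN.pair wκ)
  · refine Sig.all_lt (Sig.all_lt (Sig.imp_prim ?_ ?_) ?_) wN
    · refine Sig.comp hd (Primrec.pair (Primrec₂.natPair.comp ?_ ?_) ?_)
      · exact (Primrec.list_getD 0).comp (wκ.comp (Primrec.fst.comp Primrec.fst))
          (Primrec.snd.comp Primrec.fst)
      · exact (Primrec.list_getD 0).comp (wκ.comp (Primrec.fst.comp Primrec.fst)) Primrec.snd
      · exact (Primrec.list_getD 0).comp (wε.comp (Primrec.fst.comp Primrec.fst))
          (Primrec.snd.comp Primrec.fst)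
    · exact (Primrec.nat_le.comp (Primrec.const _) (Primrec.snd.comp Primrec.fst)).and
        ((Primrec.nat_le.comp (wN.comp (Primrec.fst.comp Primrec.fst)) Primrec.snd).and
        (primrecRel_tle.comp (Primrec.snd.comp Primrec.fst) Primrec.snd))
    · exact Primrec.nat_add.comp (Primrec.nat_mul.comp (Primrec.const 2) (wN.comp Primrec.fst))
        (Primrec.const 1)
  · exact Primrec.eq.comp (Primrec.list_length.comp wτ) wN
  · exact hR.comp wτ Primrec.fst
  · refine Sig.all_lt (Sig.and ?_ ?_) wN
    · exact Sig.comp hz (Primrec.snd.pair (Primrec.fst.comp (Primrec.unpair.comp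
        ((Primrec.list_getD 0).comp (wτ.comp Primrec.fst) Primrec.snd))))
    · exact Sig.comp hj (((Primrec.list_getD 0).comp (wκ.comp Primrec.fst) Primrec.snd).pair
        (Primrec.snd.comp (Primrec.unpair.comp
        ((Primrec.list_getD 0).comp (wτ.comp Primrec.fst) Primrec.snd))))

theorem Forces.intro {p : Cond z Γ} {R : List ℕ → ℕ → Prop} {d : ℕ → ℕ} {x N : ℕ} {k e : ℕ → ℕ}
    (hN : p.N ≤ N) (hk : FinEmb N k) (hfix : ∀ a < p.N, k a = a)
    (hd : ∀ a < N, ∀ t, t ≤ 2 * N → p.N ≤ a → N ≤ t → Tle a t → d (Nat.pair (k a) (k t)) = e a)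
    (hR : R (res (pr z (p.j ∘ k)) N) x) : p.Forces R d x := by
  have ek : ∀ a ≤ 2 * N, (res k (2 * N + 1)).getD a 0 = k a := fun a ha => getD_res (by omega)
  refine ⟨(N, res k (2 * N + 1), res e N, res (pr z (p.j ∘ k)) N), ⟨hN, fun a ha => ?_,
    hk.congr fun a ha => (ek a ha).symm⟩, fun a ha t ht h => ?_, ⟨length_res _ _, hR⟩, fun a ha => ?_⟩
  · dsimp only at *
    rw [ek a (by omega), hfix a ha]
  · dsimp only at *
    rw [ek a (by omega), ek t (by omega), getD_res ha]
    exact hd a ha t (by omega) h.1 h.2.1 h.2.2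
  · dsimp only at *
    rw [ek a (by omega), getD_res ha, pr, Nat.unpair_pair]
    exact ⟨rfl, rfl⟩

theorem Forces.elim {p : Cond z Γ} {R : List ℕ → ℕ → Prop} {d : ℕ → ℕ} {x : ℕ}
    (h : p.Forces R d x) : ∃ (N : ℕ) (k e : ℕ → ℕ), p.N ≤ N ∧ FinEmb N k ∧ (∀ a < p.N, k a = a) ∧
      (∀ a < N, ∀ t, t ≤ 2 * N → p.N ≤ a → N ≤ t → Tle a t → d (Nat.pair (k a) (k t)) = e a) ∧
      R (res (pr z (p.j ∘ k)) N) x := by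
  obtain ⟨⟨N, κ, ε, τ⟩, ⟨h1, h2, h3⟩, h4, ⟨h5, h6⟩, h7⟩ := h
  refine ⟨N, fun a => κ.getD a 0, fun a => ε.getD a 0, h1, h3, h2,
    fun a ha t ht ha' ht' hat => h4 a ha t (Nat.lt_succ_of_le ht) ⟨ha', ht', hat⟩, ?_⟩
  dsimp only at *
  convert h6
  refine List.ext_getElem? fun a => ?_
  rw [getElem?_res]
  split_ifs with ha
  · obtain ⟨e1, e2⟩ := h7 a ha
    rw [pr, Function.comp_apply, e1, e2, Nat.pair_unpair]
    simp [h5, ha]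
  · simp [h5, not_lt.1 ha]

/-- If `R` holds of `x ∉ Γ` for some finite embedding whatever the limit colors are, then some
extension of the condition forces this. -/
theorem exists_ext_of_forces (p : Cond z Γ) {R : List ℕ → ℕ → Prop} {x : ℕ} (hx : ¬ Γ x)
    (h : ∀ d ∈ Bdd p.r, p.Forces R d x) : ∃ (p' : Cond z Γ) (K : ℕ → ℕ), Ext p' p K ∧
      ∀ i ∈ p'.gen, ¬ ∀ x, Γ x ↔ ∃ n, R (res (pr z i) n) x := by
  choose T hT α hα hdense using exists_denseAbove p.lt_r
  -- The guess `d` records, for `s ≤ t`, the color of `s` that is dense above `T t`. Pairs with `s >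
  -- t` are irrelevant and get `0`.
  obtain ⟨N, k, e, hN, hk, hfix, hd, hR⟩ := (h
    (fun n => if n.unpair.1 ≤ n.unpair.2 then α n.unpair.2 n.unpair.1 else 0) (by
      intro n
      dsimp only
      split_ifs
      · exact hα _ _
      · exact p.lt_r_pos)).elim
  choose! col hcol using p.stable
  -- Each leaf is pushed up to where its color pattern is dense.
  let k' : ℕ → ℕ := fun a => if a < N then k a else T (k a)
  have hk1 : ∀ a < N, k' a = k a := fun a ha => if_pos ha
  have hk2 : ∀ a, Tle (k a) (k' a) := by
    intro a
    by_cases ha : a < N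
    · rw [hk1 a ha]; exact Tle.refl _
    · simp only [k', if_neg ha]; exact hT _
  have hk' : FinEmb N k' := by
    intro a ha
    obtain ⟨e1, e2, e3, e4⟩ := hk a ha
    rw [hk1 a ha]
    exact ⟨e1.trans (hk2 _), e2.trans (hk2 _), Tle.not_of_le e3 e4 (hk2 _) (hk2 _),
      Tle.not_of_le e4 e3 (hk2 _) (hk2 _)⟩
  obtain ⟨p', K, hext, hpN, hK⟩ := p.exists_ext (k := k')
    (col := fun a => if a < p.N then col a else e a) hN hk'
    (fun a ha => (hk1 a (ha.trans_le hN)).trans (hfix a ha)) (by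
      intro t ht ht' u hu
      have ekt : k' t = T (k t) := if_neg (not_lt.2 ht)
      rw [ekt] at hu
      obtain ⟨v, hv, hs⟩ := hdense (k t) u hu
      refine ⟨v, hv, fun a ha hat => ?_⟩
      have hkat : Tle (k a) (k t) := hk.mono ht' hat
      have htv : Tle (k t) v := ((hT _).trans hu).trans hv
      rw [hk1 a ha]
      split_ifs with h1
      · rw [hfix a h1] at hkat ⊢
        refine hcol a h1 v (le_trans ?_ htv.le) (hkat.trans htv)
        -- If `k t < p.N`, then `k` fixes `k t`, hence `k t = t` by injectivity, against `p.N ≤ N ≤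
        -- t`.
        by_contra hc
        push Not at hc
        have h2 := hfix (k t) hc
        have h3 : k t = t := Tle.antisymm
          (hk.reflect (by omega) ht' (by rw [h2]; exact Tle.refl _))
          (hk.reflect ht' (by omega) (by rw [h2]; exact Tle.refl _))
        omega
      · rw [hs (k a) hkat.le, ← hd a ha t ht' (not_lt.1 h1) ht hat]
        simp [hkat.le])
  refine ⟨p', K, hext, ?_⟩
  rintro _ ⟨K', hK', hfix', rfl, -⟩ hc
  refine hx ((hc x).2 ⟨N, ?_⟩)
  convert hR using 1
  refine res_congr fun a ha => ?_
  rw [pr, pr, hext.j_eq, Function.comp_apply, hfix' a (by omega), Function.comp_apply, hK a ha,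
    hk1 a ha, Function.comp_apply]

/-- If for some choice of limit colors `R` fails of `x ∈ Γ` for all finite embeddings, then some
extension of the condition forces this. -/
theorem exists_ext_of_not_forces (p : Cond z Γ) {R : List ℕ → ℕ → Prop} (hR : PrimrecRel R)
    (hmono : ∀ σ τ x, σ <+: τ → R σ x → R τ x) {x : ℕ} (hx : Γ x)
    (h : ∃ d ∈ Bdd p.r, ¬ p.Forces R d x) : ∃ (p' : Cond z Γ) (K : ℕ → ℕ), Ext p' p K ∧
      ∀ i ∈ p'.gen, ¬ ∀ x, Γ x ↔ ∃ n, R (res (pr z i) n) x := by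
  obtain ⟨d, hdr, hd, hdΓ⟩ := exists_not_s1_of_class p.not_s1 p.lt_r_pos
    (V := fun d _ => p.Forces R d x) ((p.sig_forces hR).comp (Primrec.const x)) h
  have ho : Comp (pr p.o d) p.o := Sig.pr_left (fun _ : Unit => p.o) fun _ => d
  have hd' : Comp (pr p.o d) d := Sig.pr_right (fun _ : Unit => p.o) fun _ => d
  -- Stability for the product coloring gives limit colors for `d`. The second entry is `0` at
  -- frozen nodes, so that their decided colors survive; `Forces` constrains `d` only at nodes from
  -- `p.N` on.
  let c' : ℕ → ℕ → ℕ := fun a b => Nat.pair (p.c a b) (if a < p.N then 0 else d (Nat.pair a b))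
  have hc' : Comp (pr p.o d) fun q : ℕ × ℕ => c' q.1 q.2 := by
    have : S1 (pr p.o d) fun q : (ℕ × ℕ) × ℕ => p.c q.1.1 q.1.2 = q.2.unpair.1 ∧
        ((q.1.1 < p.N ∧ q.2.unpair.2 = 0) ∨
          (p.N ≤ q.1.1 ∧ d (Nat.pair q.1.1 q.1.2) = q.2.unpair.2)) := by
      refine Sig.and ?_ (Sig.or (Sig.prim ?_) (Sig.and (Sig.prim ?_) ?_))
      · exact Sig.comp (p.comp_c.trans ho) (Primrec.fst.pair (Primrec.fst.comp
          (Primrec.unpair.comp Primrec.snd)))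
      · exact (Primrec.nat_lt.comp (Primrec.fst.comp Primrec.fst) (Primrec.const _)).and
          (Primrec.eq.comp (Primrec.snd.comp (Primrec.unpair.comp Primrec.snd)) (Primrec.const 0))
      · exact Primrec.nat_le.comp (Primrec.const _) (Primrec.fst.comp Primrec.fst)
      · exact Sig.comp hd' ((Primrec₂.natPair.comp (Primrec.fst.comp Primrec.fst)
          (Primrec.snd.comp Primrec.fst)).pair (Primrec.snd.comp (Primrec.unpair.comp Primrec.snd)))
    refine this.of_eq ?_
    rintro - ⟨⟨a, b⟩, v⟩
    obtain ⟨v1, v2, rfl⟩ : ∃ v1 v2, v = Nat.pair v1 v2 := ⟨_, _, (Nat.pair_unpair v).symm⟩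
    by_cases ha : a < p.N
    · simp [c', ha, Nat.pair_eq_pair, eq_comm]
    · simp [c', ha, Nat.pair_eq_pair, not_lt.1 ha]
  let p' : Cond z Γ := ⟨pr p.o d, p.j, c', (p.r + 1) ^ 2, p.N, hdΓ, p.comp_z.trans ho, p.emb,
    p.comp_j.trans ho, hc', by
      intro a b
      refine (Nat.pair_lt_max_add_one_sq _ _).trans_le (Nat.pow_le_pow_left ?_ 2)
      have h1 := p.lt_r a b
      have h2 : (if a < p.N then 0 else d (Nat.pair a b)) < p.r := by
        split_ifs
        · exact p.lt_r_pos
        · exact hdr _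
      omega, by
      intro a ha
      obtain ⟨col, hcol⟩ := p.stable a ha
      exact ⟨Nat.pair col 0, fun b hb hab => by simp [c', ha, hcol b hb hab]⟩⟩
  refine ⟨p', id, ⟨Emb.id, fun _ _ => rfl, rfl, le_rfl, ?_⟩, ?_⟩
  · intro a b b' hbb
    exact (Nat.pair_eq_pair.1 hbb).1
  rintro _ ⟨K, hK, hfix, rfl, hst⟩ hc
  obtain ⟨n, hn⟩ := (hc x).1 hx
  apply hd
  choose col B hB using hst
  let N := max n p.N
  let M := (Finset.range N).sup B
  have hM : ∀ a < N, B a ≤ M := fun a ha => Finset.le_sup (f := B) (Finset.mem_range.2 ha)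
  choose b hbM hb using fun t => Tle.exists_ge t M
  -- The leaves are moved past the bound `M` after which all nodes below `N` have reached their
  -- limit colors, so `d` is constant as `Forces` asks.
  let k : ℕ → ℕ := fun a => if a < N then K a else K (b a)
  have hk1 : ∀ a < N, k a = K a := fun a ha => if_pos ha
  have hk2 : ∀ a, Tle (K a) (k a) := by
    intro a
    by_cases ha : a < N
    · rw [hk1 a ha]; exact Tle.refl _
    · simp only [k, if_neg ha]; exact hK.iff.2 (hb a)
  refine Forces.intro (k := k) (e := fun a => (col a).unpair.2) (le_max_right n p.N) ?_ ?_ ?_ ?_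
  · intro a ha
    obtain ⟨e1, e2, e3, e4⟩ := hK N a ha
    rw [hk1 a ha]
    exact ⟨e1.trans (hk2 _), e2.trans (hk2 _), Tle.not_of_le e3 e4 (hk2 _) (hk2 _),
      Tle.not_of_le e4 e3 (hk2 _) (hk2 _)⟩
  · intro a ha
    rw [hk1 a (lt_max_of_lt_right ha), hfix a ha]
  · intro a ha t _ hpa hNt hat
    have e : k t = K (b t) := if_neg (not_lt.2 hNt)
    have hKa : p.N ≤ K a := hK.ge (N := p.N) hfix hpa
    have := hB a (b t) ((hM a ha).trans (hbM t)) (hat.trans (hb t))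
    rw [hk1 a ha, e, ← this]
    change _ = (c' _ _).unpair.2
    simp [c', not_lt.2 hKa]
  · refine hmono _ _ _ ?_ hn
    have e : res (pr z (p.j ∘ k)) N = res (pr z (p'.j ∘ K)) N :=
      res_congr fun a ha => by simp only [pr, Function.comp_apply, hk1 a ha]; rfl
    rw [e]
    exact res_prefix_res _ (le_max_left _ _)

/-- The set of `x` forced by every bounded `d` is `Σ⁰₁` in `p.o` and `Γ` is not, so they differ at
some `x`. Each direction of the difference has its own extension. -/
theorem exists_ext_avoid (p : Cond z Γ) {R : List ℕ → ℕ → Prop} (hR : PrimrecRel R)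
    (hmono : ∀ σ τ x, σ <+: τ → R σ x → R τ x) : ∃ (p' : Cond z Γ) (K : ℕ → ℕ), Ext p' p K ∧
      ∀ i ∈ p'.gen, ¬ ∀ x, Γ x ↔ ∃ n, R (res (pr z i) n) x := by
  by_cases h1 : ∃ x, Γ x ∧ ∃ d ∈ Bdd p.r, ¬ p.Forces R d x
  · obtain ⟨x, hx, h⟩ := h1
    exact p.exists_ext_of_not_forces hR hmono hx h
  by_cases h2 : ∃ x, ¬ Γ x ∧ ∀ d ∈ Bdd p.r, p.Forces R d x
  · obtain ⟨x, hx, h⟩ := h2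
    exact p.exists_ext_of_forces hx h
  push Not at h1 h2
  refine absurd (((p.sig_forces hR).forall_bdd p.lt_r_pos).of_eq fun _ x => ⟨fun h => ?_, h1 x⟩)
    p.not_s1
  by_contra hx
  obtain ⟨d, hd, hdx⟩ := h2 x hx
  exact hdx (h d hd)

/-! ### Generic sequences of conditions. -/

/-- A sufficiently long sequence of conditions has a generic embedding. -/
theorem exists_mem_gen (p : ℕ → Cond z Γ) (hext : ∀ n, ∃ K, Ext (p (n + 1)) (p n) K)
    (hN : ∀ n, n ≤ (p n).N) : ∃ i, ∀ n, i ∈ (p n).gen := by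
  have hle : ∀ n m, n ≤ m → ∃ K, Ext (p m) (p n) K := by
    intro n m hnm
    induction m, hnm using Nat.le_induction with
    | base => exact ⟨_, Ext.refl _⟩
    | succ m _ ih =>
      obtain ⟨K, hK⟩ := ih
      obtain ⟨L, hL⟩ := hext m
      exact ⟨_, hK.trans hL⟩
  choose K hK using hle
  have hj : ∀ m m' a, m ≤ m' → a < (p m).N → (p m').j a = (p m).j a := by
    intro m m' a h ha
    rw [(hK m m' h).j_eq, Function.comp_apply, (hK m m' h).fix a ha]
  refine ⟨fun a => (p (a + 1)).j a, fun n => ?_⟩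
  have hlim : ∀ m a, a < (p m).N → (p (a + 1)).j a = (p m).j a := by
    intro m a ha
    rw [← hj m _ a (le_max_left m (a + 1)) ha,
      hj (a + 1) _ a (le_max_right m (a + 1)) (hN (a + 1))]
  -- The connecting embeddings no longer change at `a` once `a` is frozen, which has happened by
  -- stage `a + 1`; `L` is their limit.
  let L : ℕ → ℕ := fun a => K n (max n (a + 1)) (le_max_left _ _) a
  have hjL : ∀ a, (p n).j (L a) = (p (a + 1)).j a := by
    intro a
    rw [hlim (max n (a + 1)) a (lt_of_lt_of_le (by omega) (hN _)),
      (hK n _ (le_max_left n (a + 1))).j_eq]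
    rfl
  have hL : ∀ m (hm : n ≤ m) a, a < (p m).N → L a = K n m hm a := by
    intro m hm a ha
    apply (p n).emb.inj
    rw [hjL, hlim m a ha, (hK n m hm).j_eq]
    rfl
  refine ⟨L, ?_, fun a ha => ?_, ?_, fun a => ?_⟩
  · intro _ a _
    have hm : n ≤ max n (2 * a + 3) := le_max_left _ _
    have hlt : ∀ b ≤ 2 * a + 2, b < (p (max n (2 * a + 3))).N := fun b hb =>
      lt_of_lt_of_le (by omega) (hN _)
    rw [hL _ hm _ (hlt a (by omega)), hL _ hm _ (hlt (2 * a + 1) (by omega)),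
      hL _ hm _ (hlt (2 * a + 2) (by omega))]
    exact (hK n _ hm).emb (a + 1) a (by omega)
  · rw [hL n le_rfl a ha, (hK n n le_rfl).fix a ha]
  · funext a
    exact (hjL a).symm
  · set m := max n (a + 1) with hm
    have hnm : n ≤ m := le_max_left _ _
    have ham : a < (p m).N := lt_of_lt_of_le (by omega) (hN m)
    obtain ⟨col, hcol⟩ := (p m).stable a ham
    have key : ∀ b ≥ (p m).N, Tle a b → ∃ b' ≥ (p m).N, Tle a b' ∧ L b = K n m hnm b' := by
      intro b hb hab
      have hm' : m ≤ max m (b + 1) := le_max_left _ _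
      have hE := hK m _ hm'
      refine ⟨K m _ hm' b, hE.emb.ge hE.fix hb, ?_, ?_⟩
      · rw [← hE.fix a ham]
        exact hE.emb.iff.2 hab
      · apply (p n).emb.inj
        rw [hjL, hlim (max m (b + 1)) b (lt_of_lt_of_le (by omega) (hN _)), hE.j_eq,
          (hK n m hnm).j_eq]
        rfl
    obtain ⟨b₀, hb₀, h₀⟩ := Tle.exists_ge a (p m).N
    -- At stage `m` the refined color of `a` is constant, so the coarser color of `p n` is constant
    -- too; its value is read off at a sample node `b₀`.
    refine ⟨(p n).c (K n m hnm a) (K n m hnm b₀), (p m).N, fun b hb hab => ?_⟩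
    obtain ⟨b', hb', hab', e⟩ := key b hb hab
    rw [e, hL m hnm a ham]
    exact (hK n m hnm).refine_c a b' b₀ ((hcol b' hb' hab').trans (hcol b₀ hb₀ h₀).symm)

/-- Alternate between freezing one more node and defeating the next candidate enumeration.
Candidates that are not monotone can be skipped, since `Sig` demands monotonicity. -/
theorem exists_generic (p₀ : Cond z Γ) : ∃ i ∈ p₀.gen, ¬ S1 (pr z i) Γ := by
  obtain ⟨e, he⟩ := (countable_primrecRel (α := List ℕ) (β := ℕ)).exists_eq_range
    ⟨fun a b => a = [b], Primrec.eq.comp Primrec.fst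
      (Primrec.list_cons.comp Primrec.snd (Primrec.const []))⟩
  have step : ∀ (n : ℕ) (p : Cond z Γ), ∃ p' : Cond z Γ, (∃ K, Ext p' p K) ∧ p.N + 1 ≤ p'.N ∧
      ((∀ σ τ x, σ <+: τ → e n σ x → e n τ x) →
        ∀ i ∈ p'.gen, ¬ ∀ x, Γ x ↔ ∃ m, e n (res (pr z i) m) x) := by
    intro n p
    obtain ⟨p', K, h, hN⟩ := p.exists_ext_succ
    by_cases hmono : ∀ σ τ x, σ <+: τ → e n σ x → e n τ x
    · have hen : PrimrecRel (e n) := by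
        have : e n ∈ Set.range e := ⟨n, rfl⟩
        rw [← he] at this
        exact this
      obtain ⟨q, L, h', hq⟩ := p'.exists_ext_avoid hen hmono
      exact ⟨q, ⟨_, h.trans h'⟩, hN ▸ h'.le, fun _ => hq⟩
    · exact ⟨p', ⟨K, h⟩, hN.ge, fun h => absurd h hmono⟩
  choose f hf1 hf2 hf3 using step
  let p : ℕ → Cond z Γ := fun n => n.rec p₀ fun n p => f n p
  have hN : ∀ n, n ≤ (p n).N := by
    intro n
    induction n with
    | zero => exact Nat.zero_le _
    | succ n ih => exact (Nat.succ_le_succ ih).trans (hf2 n (p n))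
  obtain ⟨i, hi⟩ := exists_mem_gen p (fun n => hf1 n (p n)) hN
  refine ⟨i, hi 0, ?_⟩
  rintro ⟨R, h1, h2, h3⟩
  have : R ∈ Set.range e := by rw [← he]; exact h1
  obtain ⟨n, rfl⟩ := this
  exact hf3 n (p n) h2 i (hi (n + 1)) fun x => h3 () x

end Cond

/-! ### Transfer between strings and nodes, and the conclusion. -/

/-- The coloring of pairs of nodes of the tree on `ℕ` induced by a coloring of pairs of strings. -/
theorem exists_nat_coloring {Z : Set ℕ} {f : PairColoring 2} (hf : ComputableFrom Z f) :
    ∃ c : ℕ → ℕ → ℕ, (∀ a b, c a b < 2) ∧ (Comp (Z.indicator 1) fun p : ℕ × ℕ => c p.1 p.2) ∧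
      ∀ (σ τ : BinStr) (h : ProperPrefix σ τ), c (num σ) (num τ) = f ⟨(σ, τ), h⟩ := by
  classical
  choose str hstr using num_surjective
  have hstr' : ∀ σ, str (num σ) = σ := fun σ => num_injective (hstr _)
  let c : ℕ → ℕ → ℕ := fun a b =>
    if h : ProperPrefix (str a) (str b) then f ⟨(str a, str b), h⟩ else 0
  have hc : ∀ (σ τ : BinStr) (h : ProperPrefix σ τ), c (num σ) (num τ) = f ⟨(σ, τ), h⟩ := by
    intro σ τ h
    simp only [c, hstr']
    rw [dif_pos h]
  have hcn : ∀ (σ τ : BinStr), ¬ ProperPrefix σ τ → c (num σ) (num τ) = 0 := by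
    intro σ τ h
    simp only [c, hstr']
    rw [dif_neg h]
  refine ⟨c, fun a b => ?_, ?_, hc⟩
  · simp only [c]
    split_ifs
    · exact (f _).2
    · norm_num
  obtain ⟨φ, hφ⟩ : ∃ φ : ℕ →. ℕ, φ = fun n => Part.bind (Encodable.decode (α := StrPair) n)
      fun a => (Part.some (f a)).map Encodable.encode := ⟨_, rfl⟩
  have h1 : S1 (Z.indicator 1) fun p : ℕ × ℕ => p.2 ∈ φ p.1 :=
    s1_of_recursiveIn (hφ ▸ hf : Nat.RecursiveIn _ φ)
  have key : S1 (Z.indicator 1) fun q : (ℕ × ℕ) × ℕ => ∃ w : BinStr × BinStr,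
      (num w.1 = q.1.1 ∧ num w.2 = q.1.2) ∧
      ((¬ ProperPrefix w.1 w.2 ∧ q.2 = 0) ∨ (ProperPrefix w.1 w.2 ∧
        q.2 ∈ φ (Encodable.encode w))) := by
    refine Sig.ex (Sig.and (Sig.and (Sig.prim ?_) (Sig.prim ?_)) (Sig.or (Sig.and (Sig.prim ?_)
      (Sig.prim ?_)) (Sig.and (Sig.prim ?_) ?_)))
    · exact Primrec.eq.comp (primrec_num.comp (Primrec.fst.comp Primrec.snd))
        (Primrec.fst.comp (Primrec.fst.comp Primrec.fst))
    · exact Primrec.eq.comp (primrec_num.comp (Primrec.snd.comp Primrec.snd))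
        (Primrec.snd.comp (Primrec.fst.comp Primrec.fst))
    · exact (primrecPred_properPrefix.comp Primrec.snd).not
    · exact Primrec.eq.comp (Primrec.snd.comp Primrec.fst) (Primrec.const 0)
    · exact primrecPred_properPrefix.comp Primrec.snd
    · exact Sig.comp h1 ((Primrec.encode.comp Primrec.snd).pair (Primrec.snd.comp Primrec.fst))
  have hmem : ∀ (w : BinStr × BinStr) (h : ProperPrefix w.1 w.2) (v : ℕ),
      v ∈ φ (Encodable.encode w) ↔ v = f ⟨w, h⟩ := by
    intro w h v
    rw [hφ]
    beta_reduce
    have e : Encodable.encode w = Encodable.encode (⟨w, h⟩ : StrPair) := rfl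
    rw [e, Encodable.encodek]
    simp only [Part.coe_some, Part.bind_some, Part.map_some, Part.mem_some_iff]
    rfl
  refine key.of_eq ?_
  rintro - ⟨⟨a, b⟩, v⟩
  dsimp only
  constructor
  · rintro ⟨⟨σ, τ⟩, ⟨rfl, rfl⟩, ⟨h, rfl⟩ | ⟨h, hv⟩⟩
    · exact hcn σ τ h
    · rw [hmem _ h] at hv
      rw [hv, hc σ τ h]
  · rintro rfl
    refine ⟨(str a, str b), ⟨hstr a, hstr b⟩, ?_⟩
    by_cases h : ProperPrefix (str a) (str b)
    · right
      refine ⟨h, (hmem _ h _).2 ?_⟩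
      rw [← hc _ _ h, hstr, hstr]
    · left
      refine ⟨h, ?_⟩
      rw [← hcn _ _ h, hstr, hstr]

/-- The set of strings enumerated by an embedding. -/
def rangeStr (i : ℕ → ℕ) : Set BinStr := {σ | ∃ a, num σ = i a}

theorem isoFullTree_rangeStr {i : ℕ → ℕ} (hi : Emb i) : IsoFullTree (rangeStr i) := by
  choose str hstr using num_surjective
  refine ⟨fun σ => ⟨str (i (num σ)), num σ, hstr _⟩, ⟨fun σ τ h => ?_, ?_⟩, fun σ τ => ?_⟩
  · have h1 := congrArg (fun s : rangeStr i => num s) h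
    simp only [hstr] at h1
    exact num_injective (hi.inj h1)
  · rintro ⟨τ, a, ha⟩
    refine ⟨str a, Subtype.ext (num_injective ?_)⟩
    simp only [hstr, ha]
  · rw [← tle_num_iff, ← tle_num_iff, hstr, hstr]
    exact hi.iff.symm

/-- By `Emb.le_two_mul` a preimage of `num w` is at most `2 * num w`, so a bounded search decides
whether `w` is in the range. -/
theorem comp_indicator_rangeStr {Z : Set ℕ} {i : ℕ → ℕ} (hi : Emb i) :
    Comp (pr (Z.indicator 1) i) ((join (codeSet (rangeStr i)) Z).indicator 1 : ℕ → ℕ) := by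
  classical
  have hz : Comp (pr (Z.indicator 1) i) (Z.indicator 1 : ℕ → ℕ) :=
    Sig.pr_left (fun _ : Unit => Z.indicator 1) fun _ => i
  have hi' : Comp (pr (Z.indicator 1) i) i :=
    Sig.pr_right (fun _ : Unit => Z.indicator 1) fun _ => i
  have key : S1 (pr (Z.indicator 1) i) fun q : ℕ × ℕ => ∃ n : ℕ,
      (q.1 = 2 * n + 1 ∧ Z.indicator 1 n = q.2) ∨
      (q.1 = 2 * n ∧ ((∃ w : BinStr × ℕ, (Encodable.encode w.1 = n ∧ q.2 = 1) ∧ i w.2 = num w.1) ∨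
        (((∀ s ∈ (Encodable.decode (α := BinStr) n).toList, Encodable.encode s ≠ n) ∧ q.2 = 0) ∨
        ∃ w : BinStr, (Encodable.encode w = n ∧ q.2 = 0) ∧
          ∀ a < 2 * num w + 1, ∃ v, v ≠ num w ∧ i a = v))) := by
    have dbl : Primrec fun a : ℕ => 2 * a := Primrec.nat_mul.comp (Primrec.const 2) Primrec.id
    have h0 : PrimrecPred fun n : ℕ =>
        ∀ s ∈ (Encodable.decode (α := BinStr) n).toList, Encodable.encode s ≠ n := by
      have : PrimrecRel fun (s : BinStr) (n : ℕ) => Encodable.encode s ≠ n :=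
        (Primrec.eq.comp (Primrec.encode.comp Primrec.fst) Primrec.snd).not
      exact this.forall_mem_list.comp (Primrec.optionToList.comp Primrec.decode) Primrec.id
    have h3 : S1 (pr (Z.indicator 1) i) fun q : BinStr × ℕ => ∃ v, v ≠ num q.1 ∧ i q.2 = v := by
      refine Sig.ex (Sig.and (Sig.prim ?_) ?_)
      · exact (Primrec.eq.comp Primrec.snd
          (primrec_num.comp (Primrec.fst.comp Primrec.fst))).not
      · exact Sig.comp hi' ((Primrec.snd.comp Primrec.fst).pair Primrec.snd)
    have h4 : S1 (pr (Z.indicator 1) i) fun w : BinStr =>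
        ∀ a < 2 * num w + 1, ∃ v, v ≠ num w ∧ i a = v :=
      Sig.all_lt (P := fun _ (w : BinStr) a => ∃ v, v ≠ num w ∧ i a = v) h3
        (Primrec.succ.comp (dbl.comp primrec_num))
    refine Sig.ex (Sig.or (Sig.and (Sig.prim ?_) ?_) (Sig.and (Sig.prim ?_) (Sig.or
      (Sig.ex (Sig.and (Sig.prim ?_) ?_)) (Sig.or (Sig.prim ?_)
        (Sig.ex (Sig.and (Sig.prim ?_) ?_))))))
    · exact Primrec.eq.comp (Primrec.fst.comp Primrec.fst)
        (Primrec.succ.comp (dbl.comp Primrec.snd))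
    · exact Sig.comp hz (Primrec.snd.pair (Primrec.snd.comp Primrec.fst))
    · exact Primrec.eq.comp (Primrec.fst.comp Primrec.fst) (dbl.comp Primrec.snd)
    · exact (Primrec.eq.comp (Primrec.encode.comp (Primrec.fst.comp Primrec.snd))
        (Primrec.snd.comp Primrec.fst)).and
        (Primrec.eq.comp (Primrec.snd.comp (Primrec.fst.comp Primrec.fst)) (Primrec.const 1))
    · exact Sig.comp hi' ((Primrec.snd.comp Primrec.snd).pair
        (primrec_num.comp (Primrec.fst.comp Primrec.snd)))
    · exact (h0.comp Primrec.snd).and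
        (Primrec.eq.comp (Primrec.snd.comp Primrec.fst) (Primrec.const 0))
    · exact (Primrec.eq.comp (Primrec.encode.comp Primrec.snd)
        (Primrec.snd.comp Primrec.fst)).and
        (Primrec.eq.comp (Primrec.snd.comp (Primrec.fst.comp Primrec.fst)) (Primrec.const 0))
    · exact Sig.comp h4 Primrec.snd
  have hodd : ∀ n, 2 * n + 1 ∈ join (codeSet (rangeStr i)) Z ↔ n ∈ Z := by
    intro n
    constructor
    · rintro (⟨m, -, e⟩ | ⟨m, h, e⟩)
      · omega
      · rwa [show n = m by omega]
    · exact fun h => Or.inr ⟨n, h, rfl⟩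
  have heven : ∀ n, 2 * n ∈ join (codeSet (rangeStr i)) Z ↔ n ∈ codeSet (rangeStr i) := by
    intro n
    constructor
    · rintro (⟨m, h, e⟩ | ⟨m, h, e⟩)
      · rwa [show n = m by omega]
      · omega
    · exact fun h => Or.inl ⟨n, h, rfl⟩
  have hcode : ∀ w : BinStr, Encodable.encode w ∈ codeSet (rangeStr i) ↔ ∃ a, num w = i a := by
    intro w
    constructor
    · rintro ⟨s, hs, e⟩
      obtain rfl := Encodable.encode_injective e
      exact hs
    · exact fun h => ⟨w, h, rfl⟩
  refine key.of_eq ?_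
  rintro - ⟨m, v⟩
  dsimp only
  constructor
  · rintro ⟨n, ⟨rfl, rfl⟩ | ⟨rfl, ⟨⟨w, a⟩, ⟨rfl, rfl⟩, h⟩ | ⟨h, rfl⟩ | ⟨w, ⟨rfl, rfl⟩, h⟩⟩⟩
    · simp only [Set.indicator, hodd, Pi.one_apply]
    · rw [Set.indicator_of_mem]
      · rfl
      · rw [heven, hcode]
        exact ⟨a, h.symm⟩
    · rw [Set.indicator_of_notMem]
      rw [heven]
      rintro ⟨s, -, rfl⟩
      exact h s (by simp) rfl
    · rw [Set.indicator_of_notMem]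
      rw [heven, hcode]
      rintro ⟨a, ha⟩
      obtain ⟨v, hv, e⟩ := h a (by have := hi.le_two_mul a; omega)
      exact hv (e.symm.trans ha.symm)
  · rintro rfl
    obtain ⟨n, rfl | rfl⟩ := Nat.even_or_odd' m
    · refine ⟨n, Or.inr ⟨rfl, ?_⟩⟩
      by_cases hex : ∃ w : BinStr, Encodable.encode w = n
      · obtain ⟨w, rfl⟩ := hex
        by_cases hw : ∃ a, num w = i a
        · obtain ⟨a, ha⟩ := hw
          refine Or.inl ⟨(w, a), ⟨rfl, ?_⟩, ha.symm⟩
          rw [Set.indicator_of_mem]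
          · rfl
          · rw [heven, hcode]; exact ⟨a, ha⟩
        · refine Or.inr (Or.inr ⟨w, ⟨rfl, ?_⟩, fun a _ => ⟨i a, fun e => hw ⟨a, e.symm⟩, rfl⟩⟩)
          rw [Set.indicator_of_notMem]
          rwa [heven, hcode]
      · refine Or.inr (Or.inl ⟨fun s _ e => hex ⟨s, e⟩, ?_⟩)
        rw [Set.indicator_of_notMem]
        rw [heven]
        rintro ⟨s, -, e⟩
        exact hex ⟨s, e⟩
    · refine ⟨n, Or.inl ⟨rfl, ?_⟩⟩
      simp only [Set.indicator, hodd, Pi.one_apply]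

/-- The coded graph of the characteristic function of `C`. -/
def charGraph (C : Set ℕ) (x : ℕ) : Prop := (C.indicator 1 x.unpair.1 : ℕ) = x.unpair.2

/-- `Comp` already speaks of the graph, so only pairs are recoded as numbers. Nonreducibility of `C`
thereby becomes non-enumerability of a single set, the form the forcing preserves. -/
theorem s1_charGraph_iff {o : ℕ → ℕ} {C : Set ℕ} :
    S1 o (charGraph C) ↔ Comp o (C.indicator 1 : ℕ → ℕ) := by
  constructor
  · intro h
    exact (Sig.comp h Primrec₂.natPair).of_eq fun _ p => by simp [charGraph]
  · intro h
    exact Sig.comp h Primrec.unpair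

end ColoringTrees

open ColoringTrees
theorem mainTheorem5 (Z C : Set ℕ) (hC : ¬ SetTuringReducible C Z)
    (f : PairColoring 2) (hf : ComputableFrom Z f) :
    ∃ H : Set BinStr, IsoFullTree H ∧ StableOver f H ∧
      ¬ SetTuringReducible C (join (codeSet H) Z) := by
  obtain ⟨c, hc2, hcc, hcf⟩ := exists_nat_coloring hf
  rw [setTuringReducible_iff, ← s1_charGraph_iff] at hC
  let p₀ : Cond (Z.indicator 1) (charGraph C) := ⟨Z.indicator 1, id, c, 2, 0, hC, Comp.refl _,
    Emb.id, Comp.of_primrec Primrec.id, hcc, hc2, fun a ha => absurd ha (Nat.not_lt_zero a)⟩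
  obtain ⟨i, ⟨i', hi, -, rfl, hst⟩, hΓ⟩ := p₀.exists_generic
  change ∀ a, ∃ col B, ∀ b ≥ B, Tle a b → c (i' a) (i' b) = col at hst
  change ¬ S1 (pr _ i') _ at hΓ
  refine ⟨rangeStr i', isoFullTree_rangeStr hi, ?_, fun h => hΓ ?_⟩
  · rintro σ ⟨a, ha⟩
    obtain ⟨col, B, hB⟩ := hst a
    choose str hstr using num_surjective
    obtain ⟨b₀, hb₀, h₀⟩ := Tle.exists_ge a B
    have hcol : col < 2 := hB b₀ hb₀ h₀ ▸ hc2 _ _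
    -- A string of the range longer than all those with index below `B` has index at least `B`,
    -- where the color is constant.
    refine ⟨⟨col, hcol⟩, (Finset.range B).sup fun b => (str (i' b)).length, ?_⟩
    rintro τ ⟨b, hb⟩ h hlen
    have hBb : B ≤ b := by
      by_contra hlt
      have e : str (i' b) = τ := num_injective ((hstr _).trans hb.symm)
      have := Finset.le_sup (f := fun b => (str (i' b)).length)
        (Finset.mem_range.2 (not_le.1 hlt))
      simp only [e] at this
      omega
    have hab : Tle a b := by
      rw [← hi.iff, ← ha, ← hb, tle_num_iff]
      exact h.1
    refine Fin.ext ?_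
    rw [← hcf σ τ h, ha, hb]
    exact hB b hBb hab
  · rw [setTuringReducible_iff] at h
    exact s1_charGraph_iff.2 (h.trans (comp_indicator_rangeStr hi))
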